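/- Let $\sigma\in[\tfrac54,2]$ and $m\in\mathbb N$ with $m\ge 2$, and put $\beta=2\pi m\bigl(1-\tfrac1{2\sigma}\bigr)$. Let $$\varphi_{0}(x)=\frac{1}{\cosh\beta-1}\,\frac{\cosh\bigl(\beta\sqrt{1-x^2}\bigr)-1}{\sqrt{1-x^2}}\quad(|x|<1),\qquad \varphi_0(x)=0\quad(|x|\ge 1),$$ and, for a positive integer $N_1$, let $\varphi_{\mathrm{mcosh}}(x)=\varphi_0(N_1x/m)$, $x\in\mathbb R$, be the modified $\cosh$-type window function, with Fourier transform $\hat\varphi(v)=\int_{\mathbb R}\varphi(t)\,e^{-2\pi i vt}\,dt$. For a positive even integer $N$ for which $N_1=\sigma N$ is an even integer, let $I_N=\{-N/2,\dots,N/2-1\}$ and, with $\varphi=\varphi_{\mathrm{mcosh}}$ formed with this $N_1$, $$e_{\sigma,N}(\varphi)=\max_{n\in I_N}\Bigl\|\sum_{r\in\mathbb Z\setminus\{0\}}\frac{\hat\varphi(n+rN_1)}{\hat\varphi(n)}\,e^{2\pi i rN_1\,\cdot}\Bigr\|_{C(\mathbb T)},\qquad e_\sigma(\varphi_{\mathrm{mcosh}})=\sup_N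 e_{\sigma,N}(\varphi_{\mathrm{mcosh}}),$$ where $C(\mathbb T)$ is the space of continuous functions on $\mathbb T=\mathbb R/\mathbb Z$ with the maximum norm, and the supremum is over all positive even integers $N$ such that $\sigma N$ is an even integer (it is $0$ if there is no such $N$, that is, if $\sigma$ is irrational). Let $I_0(x)=\sum_{k\ge0}\frac{x^{2k}}{2^{2k}(k!)^2}$ be the modified Bessel function of order $0$. Then the error constant is well defined, that is, for all such $N$ and all $n\in I_N$ one has $\hat\varphi(n)\neq0$ and the series above converges (unconditionally) in $C(\mathbb T)$. Moreover $$e_{\sigma}(\varphi_{\mathrm{mcosh}})\le\frac{21}{4}\Bigl[I_0\bigl(2\pi m\sqrt{1-\tfrac1\sigma}\bigr)+\tfrac12\Bigr]^{-1},$$ and also, with exponential decay in $m$, $$e_{\sigma}(\varphi_{\mathrm{mcosh}})\le\frac{21}{4}\Bigl(1+4\pi m\sqrt{1-\tfrac1\sigma}\Bigr)\Bigl[e^{2\pi m\sqrt{1-1/\sigma}}+\tfrac12+2\pi m\sqrt{1-\tfrac1\sigma}\Bigr]^{-1}.$$ -/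

import Mathlib

open scoped ENNReal FourierTransform

noncomputable section

/-- The modified Bessel function of the first kind of order zero,
`I₀(x) = ∑ₖ x^(2k) / (2^(2k) (k!)^2)`. -/
def besselI0 (x : ℝ) : ℝ :=
  ∑' k : ℕ, x ^ (2 * k) / (2 ^ (2 * k) * (k.factorial : ℝ) ^ 2)

/-- The shape parameter `β = 2πm (1 - 1/(2σ))`. -/
def shapeParam (σ : ℝ) (m : ℕ) : ℝ :=
  2 * Real.pi * m * (1 - 1 / (2 * σ))

open Classical in
/-- The unscaled modified cosh-type window function with shape parameter `β`; it is supported on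
`[-1, 1]`. -/
def mcosh0 (β : ℝ) (x : ℝ) : ℝ :=
  if x ∈ Set.Ioo (-1 : ℝ) 1 then
    1 / (Real.cosh β - 1) * ((Real.cosh (β * √(1 - x ^ 2)) - 1) / √(1 - x ^ 2))
  else 0

/-- The modified cosh-type window function `x ↦ φ₀(N₁ x / m)` with shape parameter
`β = 2πm (1 - 1/(2σ))`. -/
def mcoshWindow (σ : ℝ) (m : ℕ) (N₁ : ℕ) (x : ℝ) : ℝ :=
  mcosh0 (shapeParam σ m) (N₁ * x / m)

/-- The Fourier transform `φ̂(v) = ∫ φ(t) exp(-2πi v t) dt` of a real function. -/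
def windowFT (φ : ℝ → ℝ) (v : ℝ) : ℂ :=
  𝓕 (fun t : ℝ => (φ t : ℂ)) v

/-- The index set `I_N = {-N/2, …, N/2 - 1}` (for even `N`). -/
def indexSet (N : ℕ) : Finset ℤ :=
  Finset.Ico (-((N / 2 : ℕ) : ℤ)) ((N / 2 : ℕ) : ℤ)

/-- The pairs `(N, N₁)` of positive even integers with `N₁ = σ N`. -/
def Admissible (σ : ℝ) (N N₁ : ℕ) : Prop :=
  0 < N ∧ Even N ∧ Even N₁ ∧ (N₁ : ℝ) = σ * N

/-- The summand `φ̂(n + r N₁) / φ̂(n) · exp(2πi r N₁ ·)`, an element of the Banach space `C(𝕋)` of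
continuous functions on `𝕋 = ℝ/ℤ` with the maximum norm. -/
def aliasTerm (φ : ℝ → ℝ) (N₁ : ℕ) (n r : ℤ) : C(UnitAddCircle, ℂ) :=
  (windowFT φ ((n : ℝ) + r * N₁) / windowFT φ n) • (fourier (r * N₁) : C(UnitAddCircle, ℂ))

/-- The constant `e_{σ,N}(φ)`: the maximum over `n ∈ I_N` of the `C(𝕋)`-norm of the sum over
`r ∈ ℤ \ {0}` of the functions `aliasTerm`. -/
def errorConstN (φ : ℝ → ℝ) (N N₁ : ℕ) : ℝ≥0∞ :=
  ⨆ n ∈ indexSet N, ‖∑' r : {r : ℤ // r ≠ 0}, aliasTerm φ N₁ n r‖ₑ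

/-- The `C(𝕋)`-error constant `e_σ(φ)` of a window function `φ = φ_{N₁}` depending on `N₁`: the
supremum in `[0, ∞]` of `e_{σ,N}(φ_{N₁})` over all positive even `N` for which `N₁ = σ N` is an even
integer. -/
def errorConst (σ : ℝ) (φ : ℕ → ℝ → ℝ) : ℝ≥0∞ :=
  ⨆ (N : ℕ) (N₁ : ℕ) (_ : Admissible σ N N₁), errorConstN (φ N₁) N N₁

end

/-! Write `L = 2πm`, `b = 1 - 1/(2σ)` and `F(z) = ∑ z^k/(k!)²`, so that `I₀(x) = F(x²/4)` and `J₀(x)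
= F(-x²/4)`. The substitution `x = sin t` turns the Fourier transform of the window into a positive
constant times `F(((Lb)² - (Lt)²)/4) - F(-(Lt)²/4)` with `t = v/N₁` (`windowFT_mcoshWindow`). The
constant cancels in every quotient.

For `n ∈ I_N` one has `|t| ≤ 1 - b`, the first argument is nonnegative, and monotonicity of `F`
together with `|J₀| ≤ 1` gives at least `I₀(L√(1-1/σ)) - 1` (`besselI0_sub_one_le`). At an aliased
frequency `|t| ≥ b`, and the value is `J₀(√((Lt)²-(Lb)²)) - J₀(Lt)`, which is `besselDiff`. The
heart of the proof is that these differences sum in absolute value to at most `5.25 - 3/L`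
(`sum_besselDiff_le`).

Since `J₀` decays only like `x^(-1/2)`, convergence needs cancellation in the difference, and the
constant needs sharp information on `u = √x J₀`. It solves `u'' + (1 + 1/(4x²))u = 0`: its energy
decreases, which bounds `u`, and `(u + iu')e^{ix}` is nearly constant, which determines `u` and `u'`
up to a small error. Because `m` is an integer, the phases of `L(r ± s)` modulo `2π` do not depend
on `r`. Hence `|u|` and `|u'|` have uniform bounds `p`, `q` along one progression and `q`, `p` along
the other, with `p + q` barely above `2/√π` (`exists_phase_bounds`). Small `r` are estimated by the
triangle inequality and large `r` by the difference, with the cutoff proportional to `b²L`.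

The spare `3/L` pays for replacing `I₀ - 1` by `I₀ + 1/2`, because `I₀` exceeds a multiple of `L`
(`linear_le_besselI0`). The exponential bound then follows from `e^x ≤ (1 + 2x) I₀(x)`
(`exp_le_mul_besselI0`). -/

/-! ### Power series for the Bessel functions and their differential equation. -/

/-- The entire function `z ↦ ∑ z^k / (k!)^2`. -/
noncomputable def besselF (z : ℝ) : ℝ := ∑' k : ℕ, z ^ k / (k.factorial : ℝ) ^ 2

/-- The entire function `z ↦ ∑ z^k / (k! (k+1)!)`. -/
noncomputable def besselG (z : ℝ) : ℝ :=
  ∑' k : ℕ, z ^ k / ((k.factorial : ℝ) * ((k + 1).factorial : ℝ))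

theorem summable_coeff_mul_pow {a : ℕ → ℝ} (ha : ∀ k, |a k| ≤ 1 / (k.factorial : ℝ)) (z : ℝ) :
    Summable fun k => a k * z ^ k := by
  refine Summable.of_norm_bounded (Real.summable_pow_div_factorial |z|) fun k => ?_
  rw [norm_mul, norm_pow, Real.norm_eq_abs, Real.norm_eq_abs]
  calc |a k| * |z| ^ k ≤ 1 / (k.factorial : ℝ) * |z| ^ k := by gcongr; exact ha k
    _ = |z| ^ k / k.factorial := by ring

theorem hasDerivAt_tsum_coeff_mul_pow {a : ℕ → ℝ} (ha : ∀ k, |a k| ≤ 1 / (k.factorial : ℝ))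
    (z : ℝ) :
    HasDerivAt (fun z => ∑' k, a k * z ^ k) (∑' k : ℕ, ((k : ℝ) + 1) * a (k + 1) * z ^ k) z := by
  set R : ℝ := |z| + 1
  have hR : 0 ≤ R := by positivity
  have hu : Summable fun k : ℕ => |a k| * (k * R ^ (k - 1)) := by
    rw [← summable_nat_add_iff 1]
    refine Summable.of_nonneg_of_le (fun k => by positivity) (fun k => ?_)
      (Real.summable_pow_div_factorial R)
    have h := ha (k + 1)
    rw [Nat.factorial_succ, Nat.cast_mul] at h
    have hk : (0 : ℝ) < k.factorial := by positivity
    calc |a (k + 1)| * (((k + 1 : ℕ) : ℝ) * R ^ (k + 1 - 1))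
        ≤ 1 / (((k + 1 : ℕ) : ℝ) * k.factorial) * (((k + 1 : ℕ) : ℝ) * R ^ k) := by
          simp only [Nat.add_sub_cancel]; gcongr
      _ = R ^ k / k.factorial := by field_simp
  have hz : z ∈ Metric.ball (0 : ℝ) R := by simp [R]
  have key := hasDerivAt_tsum_of_isPreconnected (g := fun k z => a k * z ^ k)
    (g' := fun k z => a k * (k * z ^ (k - 1))) hu Metric.isOpen_ball
    (convex_ball (0 : ℝ) R).isPreconnected
    (fun k y _ => (hasDerivAt_pow k y).const_mul (a k))
    (fun k y hy => by
      have hy' : |y| ≤ R := by simpa using (Metric.mem_ball.1 hy).le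
      rw [norm_mul, norm_mul, norm_pow, Real.norm_eq_abs, Real.norm_eq_abs, Real.norm_eq_abs,
        Nat.abs_cast]
      gcongr)
    hz (summable_coeff_mul_pow ha z) hz
  have hs : Summable fun k : ℕ => a k * (k * z ^ (k - 1)) := by
    refine Summable.of_norm_bounded hu fun k => ?_
    rw [norm_mul, norm_mul, norm_pow, Real.norm_eq_abs, Real.norm_eq_abs, Real.norm_eq_abs,
        Nat.abs_cast]
    gcongr
    simp [R]
  rw [hs.tsum_eq_zero_add] at key
  refine key.congr_deriv ?_
  simp only [Nat.cast_zero, zero_mul, mul_zero, zero_add, Nat.add_sub_cancel]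
  refine tsum_congr fun k => ?_
  push_cast; ring

theorem abs_inv_factorial_sq_le (k : ℕ) :
    |1 / (k.factorial : ℝ) ^ 2| ≤ 1 / (k.factorial : ℝ) := by
  have h1 : (1 : ℝ) ≤ k.factorial := by exact_mod_cast k.factorial_pos
  rw [abs_of_nonneg (by positivity)]
  gcongr
  nlinarith

theorem besselF_eq (z : ℝ) : besselF z = ∑' k : ℕ, (1 / (k.factorial : ℝ) ^ 2) * z ^ k :=
  tsum_congr fun k => by ring

theorem summable_besselF (z : ℝ) : Summable fun k : ℕ => z ^ k / (k.factorial : ℝ) ^ 2 :=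
  (summable_coeff_mul_pow abs_inv_factorial_sq_le z).congr fun k => by ring

theorem hasDerivAt_besselF (z : ℝ) : HasDerivAt besselF (besselG z) z := by
  have h := hasDerivAt_tsum_coeff_mul_pow abs_inv_factorial_sq_le z
  have e : besselG z =
      ∑' k : ℕ, ((k : ℝ) + 1) * (1 / ((k + 1).factorial : ℝ) ^ 2) * z ^ k := by
    refine tsum_congr fun k => ?_
    have hk : (k.factorial : ℝ) ≠ 0 := by positivity
    have hk' : (k : ℝ) + 1 ≠ 0 := by positivity
    rw [Nat.factorial_succ]; push_cast; field_simp
  rw [e]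
  exact h.congr_of_eventuallyEq (Filter.Eventually.of_forall besselF_eq)

theorem abs_div_factorial_sq_le (k : ℕ) :
    |(k : ℝ) / (k.factorial : ℝ) ^ 2| ≤ 1 / (k.factorial : ℝ) := by
  have h1 : (k : ℝ) ≤ k.factorial := by exact_mod_cast k.self_le_factorial
  have h2 : (0 : ℝ) < k.factorial := by positivity
  rw [abs_of_nonneg (by positivity), div_le_div_iff₀ (by positivity) h2]
  nlinarith

theorem mul_besselG_eq (z : ℝ) : z * besselG z =
    ∑' k : ℕ, ((k : ℝ) / (k.factorial : ℝ) ^ 2) * z ^ k := by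
  rw [(summable_coeff_mul_pow abs_div_factorial_sq_le z).tsum_eq_zero_add, besselG, ← tsum_mul_left]
  simp only [Nat.cast_zero, zero_div, zero_mul, zero_add]
  refine tsum_congr fun k => ?_
  have hk : (k.factorial : ℝ) ≠ 0 := by positivity
  have hk' : (k : ℝ) + 1 ≠ 0 := by positivity
  rw [Nat.factorial_succ]; push_cast; field_simp; ring

/-- With `besselG` the derivative of `besselF`, this is Bessel's equation `(zF')' = F`. -/
theorem hasDerivAt_mul_besselG (z : ℝ) :
    HasDerivAt (fun z => z * besselG z) (besselF z) z := by
  have h := hasDerivAt_tsum_coeff_mul_pow abs_div_factorial_sq_le z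
  have e : besselF z =
      ∑' k : ℕ, ((k : ℝ) + 1) * (((k + 1 : ℕ) : ℝ) / ((k + 1).factorial : ℝ) ^ 2) * z ^ k := by
    refine tsum_congr fun k => ?_
    have hk : (k.factorial : ℝ) ≠ 0 := by positivity
    have hk' : (k : ℝ) + 1 ≠ 0 := by positivity
    rw [Nat.factorial_succ]; push_cast; field_simp
  rw [e]
  exact h.congr_of_eventuallyEq (Filter.Eventually.of_forall mul_besselG_eq)

theorem hasDerivAt_besselG {z : ℝ} (hz : z ≠ 0) :
    HasDerivAt besselG ((besselF z - besselG z) / z) z := by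
  have h := (hasDerivAt_mul_besselG z).div (hasDerivAt_id z) hz
  have e : besselG =ᶠ[nhds z] fun y => y * besselG y / y := by
    filter_upwards [isOpen_ne.mem_nhds hz] with y hy
    have : y ≠ 0 := hy
    field_simp
  refine (h.congr_of_eventuallyEq e).congr_deriv ?_
  simp only [id]
  field_simp

theorem besselF_mono {z w : ℝ} (hz : 0 ≤ z) (hzw : z ≤ w) : besselF z ≤ besselF w :=
  (summable_besselF z).tsum_le_tsum (fun k => by gcongr) (summable_besselF w)

theorem besselI0_eq (x : ℝ) : besselI0 x = besselF (x ^ 2 / 4) :=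
  tsum_congr fun k => by
    rw [div_pow, ← pow_mul, div_div]
    congr 2
    rw [pow_mul]; norm_num

theorem sum_le_besselF {z : ℝ} (hz : 0 ≤ z) (K : ℕ) :
    ∑ k ∈ Finset.range K, z ^ k / (k.factorial : ℝ) ^ 2 ≤ besselF z :=
  (summable_besselF z).sum_le_tsum _ fun k _ => by positivity

/-! ### Certified numerical values at negative arguments. -/

theorem abs_tsum_sub_sum_range_le {c : ℕ → ℝ} (hc : Summable c) {K : ℕ} {A : ℝ}
    (h : ∀ j, |c (K + j)| ≤ A * (1 / 2) ^ j) :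
    |∑' k, c k - ∑ k ∈ Finset.range K, c k| ≤ 2 * A := by
  rw [← hc.sum_add_tsum_nat_add K, add_sub_cancel_left, ← Real.norm_eq_abs]
  have hs : HasSum (fun j : ℕ => A * (1 / 2 : ℝ) ^ j) (A * 2) := hasSum_geometric_two.mul_left A
  rw [mul_comm]
  refine tsum_of_norm_bounded hs fun j => ?_
  rw [add_comm, Real.norm_eq_abs]; exact h j

/-- From index `K` on, consecutive terms have ratio at most `z/(K+1)² ≤ 1/2`, so the tail is
dominated by a geometric series. The cases `e = 0` and `e = 1` serve `besselF` and `besselG`. -/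
theorem pow_div_factorial_mul_le {z : ℝ} (hz : 0 ≤ z) {K : ℕ} (e : ℕ)
    (hK : z ≤ (K + 1 : ℝ) ^ 2 / 2) (j : ℕ) :
    |(-z) ^ (K + j) / (((K + j).factorial : ℝ) * ((K + j + e).factorial : ℝ))| ≤
      z ^ K / ((K.factorial : ℝ) * ((K + e).factorial : ℝ)) * (1 / 2) ^ j := by
  have h1 : (K.factorial : ℝ) * (K + 1) ^ j ≤ ((K + j).factorial : ℝ) := by
    exact_mod_cast Nat.factorial_mul_pow_le_factorial
  have h2 : ((K + e).factorial : ℝ) * (K + 1) ^ j ≤ ((K + j + e).factorial : ℝ) := by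
    have : ((K + e).factorial : ℝ) * (K + e + 1) ^ j ≤ ((K + e + j).factorial : ℝ) := by
      exact_mod_cast Nat.factorial_mul_pow_le_factorial
    rw [show K + j + e = K + e + j by ring]
    refine le_trans ?_ this
    gcongr
    linarith [(Nat.cast_nonneg e : (0 : ℝ) ≤ e)]
  rw [abs_div, abs_pow, abs_neg, abs_of_nonneg hz, abs_of_nonneg (by positivity)]
  calc z ^ (K + j) / (((K + j).factorial : ℝ) * ((K + j + e).factorial : ℝ))
      ≤ z ^ (K + j) / ((K.factorial * (K + 1) ^ j) * ((K + e).factorial * (K + 1) ^ j)) := by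
        gcongr
    _ = z ^ K / ((K.factorial : ℝ) * ((K + e).factorial : ℝ)) * (z / (K + 1) ^ 2) ^ j := by
        rw [pow_add, div_pow, ← pow_mul, mul_comm 2 j, pow_mul]; field_simp
    _ ≤ _ := by
        have h3 : z / (K + 1) ^ 2 ≤ 1 / 2 := by rw [div_le_iff₀ (by positivity)]; linarith
        exact mul_le_mul_of_nonneg_left (pow_le_pow_left₀ (by positivity) h3 j) (by positivity)

theorem abs_besselF_neg_sub_le {z : ℝ} (hz : 0 ≤ z) {K : ℕ} (hK : z ≤ (K + 1 : ℝ) ^ 2 / 2) :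
    |besselF (-z) - ∑ k ∈ Finset.range K, (-z) ^ k / (k.factorial : ℝ) ^ 2| ≤
      2 * (z ^ K / (K.factorial : ℝ) ^ 2) := by
  refine abs_tsum_sub_sum_range_le (summable_besselF (-z)) fun j => ?_
  simpa [pow_two] using pow_div_factorial_mul_le hz 0 hK j

theorem summable_besselG (z : ℝ) :
    Summable fun k : ℕ => z ^ k / ((k.factorial : ℝ) * ((k + 1).factorial : ℝ)) := by
  refine (summable_coeff_mul_pow (a := fun k => 1 / ((k.factorial : ℝ) * ((k + 1).factorial : ℝ)))
    (fun k => ?_) z).congr fun k => by ring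
  rw [abs_of_nonneg (by positivity)]
  have h1 : (1 : ℝ) ≤ (k + 1).factorial := by exact_mod_cast (k + 1).factorial_pos
  have h2 : (0 : ℝ) < k.factorial := by positivity
  gcongr
  nlinarith

theorem abs_besselG_neg_sub_le {z : ℝ} (hz : 0 ≤ z) {K : ℕ} (hK : z ≤ (K + 1 : ℝ) ^ 2 / 2) :
    |besselG (-z) -
        ∑ k ∈ Finset.range K, (-z) ^ k / ((k.factorial : ℝ) * ((k + 1).factorial : ℝ))| ≤
      2 * (z ^ K / ((K.factorial : ℝ) * ((K + 1).factorial : ℝ))) :=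
  abs_tsum_sub_sum_range_le (summable_besselG (-z)) fun j => pow_div_factorial_mul_le hz 1 hK j

theorem besselF_neg_nine : |besselF (-9) - 0.150645| ≤ 0.00001 := by
  have h := abs_besselF_neg_sub_le (z := 9) (by norm_num) (K := 14) (by norm_num)
  have e : |∑ k ∈ Finset.range 14, (-9 : ℝ) ^ k / (k.factorial : ℝ) ^ 2 - 0.150645| +
      2 * (9 ^ 14 / (Nat.factorial 14 : ℝ) ^ 2) ≤ 0.00001 := by
    norm_num [Finset.sum_range_succ, Nat.factorial, abs_le]
  linarith [abs_sub_le (besselF (-9))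
    (∑ k ∈ Finset.range 14, (-9 : ℝ) ^ k / (k.factorial : ℝ) ^ 2) 0.150645]

theorem besselG_neg_nine : |besselG (-9) + 0.092228| ≤ 0.00001 := by
  have h := abs_besselG_neg_sub_le (z := 9) (by norm_num) (K := 14) (by norm_num)
  have e : |∑ k ∈ Finset.range 14, (-9 : ℝ) ^ k / ((k.factorial : ℝ) * ((k + 1).factorial : ℝ))
      - (-0.092228)| + 2 * (9 ^ 14 / ((Nat.factorial 14 : ℝ) * (Nat.factorial (14 + 1) : ℝ)))
      ≤ 0.00001 := by
    norm_num [Finset.sum_range_succ, Nat.factorial, abs_le]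
  have := abs_sub_le (besselG (-9))
    (∑ k ∈ Finset.range 14, (-9 : ℝ) ^ k / ((k.factorial : ℝ) * ((k + 1).factorial : ℝ)))
      (-0.092228)
  rw [sub_neg_eq_add] at this e
  rw [sub_neg_eq_add] at this
  linarith
-- The argument is `-x²/4` for `x² = 12633/5`, a rational approximation of `(16π)²`; there the phase
-- `e^{ix}` is almost `1`.
theorem besselF_neg_far : |besselF (-(12633 / 20)) - 0.079363| ≤ 0.00001 := by
  have h := abs_besselF_neg_sub_le (z := 12633 / 20) (by norm_num) (K := 76) (by norm_num)
  have e : |∑ k ∈ Finset.range 76, (-(12633 / 20) : ℝ) ^ k / (k.factorial : ℝ) ^ 2 - 0.079363| +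
      2 * ((12633 / 20) ^ 76 / (Nat.factorial 76 : ℝ) ^ 2) ≤ 0.00001 := by
    norm_num [Finset.sum_range_succ, Nat.factorial, abs_le]
  linarith [abs_sub_le (besselF (-(12633 / 20)))
    (∑ k ∈ Finset.range 76, (-(12633 / 20) : ℝ) ^ k / (k.factorial : ℝ) ^ 2) 0.079363]

theorem besselG_neg_far : |besselG (-(12633 / 20)) + 0.003143| ≤ 0.000001 := by
  have h := abs_besselG_neg_sub_le (z := 12633 / 20) (by norm_num) (K := 76) (by norm_num)
  have e : |∑ k ∈ Finset.range 76, (-(12633 / 20) : ℝ) ^ k /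
        ((k.factorial : ℝ) * ((k + 1).factorial : ℝ)) - (-0.003143)| +
      2 * ((12633 / 20) ^ 76 / ((Nat.factorial 76 : ℝ) * (Nat.factorial (76 + 1) : ℝ)))
      ≤ 0.000001 := by
    norm_num [Finset.sum_range_succ, Nat.factorial, abs_le]
  have := abs_sub_le (besselG (-(12633 / 20)))
    (∑ k ∈ Finset.range 76, (-(12633 / 20) : ℝ) ^ k /
      ((k.factorial : ℝ) * ((k + 1).factorial : ℝ))) (-0.003143)
  rw [sub_neg_eq_add] at this e
  rw [sub_neg_eq_add] at this
  linarith

/-! ### The normal form `√x J₀(x)`: energy, phase and pointwise bounds. -/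

/-- The Bessel function of the first kind of order zero. -/
noncomputable def besselJ0 (x : ℝ) : ℝ := besselF (-(x ^ 2 / 4))

/-- The Liouville normal form `√x J₀(x)` of the Bessel function. -/
noncomputable def normJ0 (x : ℝ) : ℝ := √x * besselJ0 x

/-- The derivative of `√x J₀(x)`. -/
noncomputable def normJ0' (x : ℝ) : ℝ :=
  besselJ0 x / (2 * √x) - √x * (x / 2 * besselG (-(x ^ 2 / 4)))

theorem hasDerivAt_besselJ0 (x : ℝ) :
    HasDerivAt besselJ0 (-(x / 2 * besselG (-(x ^ 2 / 4)))) x := by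
  have h1 : HasDerivAt (fun x : ℝ => -(x ^ 2 / 4)) (-(x / 2)) x := by
    refine (((hasDerivAt_pow 2 x).div_const 4).neg).congr_deriv ?_
    norm_num; ring
  refine ((hasDerivAt_besselF _).comp x h1).congr_deriv ?_
  ring

theorem hasDerivAt_normJ0 {x : ℝ} (hx : 0 < x) : HasDerivAt normJ0 (normJ0' x) x := by
  refine ((Real.hasDerivAt_sqrt hx.ne').mul (hasDerivAt_besselJ0 x)).congr_deriv ?_
  rw [normJ0']; ring

theorem hasDerivAt_normJ0' {x : ℝ} (hx : 0 < x) :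
    HasDerivAt normJ0' (-((1 + 1 / (4 * x ^ 2)) * normJ0 x)) x := by
  have h1 : HasDerivAt (fun x : ℝ => -(x ^ 2 / 4)) (-(x / 2)) x := by
    refine (((hasDerivAt_pow 2 x).div_const 4).neg).congr_deriv ?_
    norm_num; ring
  have hz : -(x ^ 2 / 4) ≠ 0 := by
    have : 0 < x ^ 2 := by positivity
    linarith
  have hG := (hasDerivAt_besselG hz).comp x h1
  have hs := Real.hasDerivAt_sqrt hx.ne'
  have hr : 0 < √x := Real.sqrt_pos.2 hx
  have h := ((hasDerivAt_besselJ0 x).div (hs.const_mul 2) (by positivity)).sub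
    (hs.mul (((hasDerivAt_id x).div_const 2).mul hG))
  refine h.congr_deriv ?_
  simp only [normJ0, besselJ0, Function.comp, id, Pi.mul_apply]
  set r := √x with hrdef
  have hxr : x = r ^ 2 := (Real.sq_sqrt hx.le).symm
  clear_value r
  subst hxr
  field_simp
  ring

theorem besselJ0_eq {x : ℝ} (hx : 0 < x) : besselJ0 x = normJ0 x / √x := by
  have hr : 0 < √x := Real.sqrt_pos.2 hx
  rw [normJ0]; field_simp

/-- The energy of `√x J₀(x)` is nonincreasing. -/
theorem energy_antitoneOn :
    AntitoneOn (fun x => normJ0' x ^ 2 + (1 + 1 / (4 * x ^ 2)) * normJ0 x ^ 2) (Set.Ioi 0) := by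
  have hd : ∀ x ∈ Set.Ioi (0 : ℝ), HasDerivAt
      (fun x => normJ0' x ^ 2 + (1 + 1 / (4 * x ^ 2)) * normJ0 x ^ 2)
      (-(normJ0 x ^ 2 / (2 * x ^ 3))) x := by
    intro x hx
    have hx : 0 < x := hx
    have hq : HasDerivAt (fun x : ℝ => 1 + 1 / (4 * x ^ 2)) (-(1 / (2 * x ^ 3))) x := by
      have := ((hasDerivAt_const x (1 : ℝ)).div ((hasDerivAt_pow 2 x).const_mul 4)
        (by positivity)).const_add 1
      refine this.congr_deriv ?_
      field_simp
      norm_num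
      ring
    refine (((hasDerivAt_normJ0' hx).pow 2).add (hq.mul ((hasDerivAt_normJ0 hx).pow 2))).congr_deriv
      ?_
    norm_num
    ring
  refine antitoneOn_of_deriv_nonpos (convex_Ioi 0)
    (fun x hx => (hd x hx).continuousAt.continuousWithinAt) ?_ ?_
  · intro x hx
    rw [interior_Ioi] at hx
    exact (hd x hx).differentiableAt.differentiableWithinAt
  · intro x hx
    rw [interior_Ioi] at hx
    rw [(hd x hx).deriv]
    have : 0 < x := hx
    have : 0 ≤ normJ0 x ^ 2 / (2 * x ^ 3) := by positivity
    linarith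

/-- Starting value for the monotone energy. Since `0.64 = 0.8²`, it gives `|√x J₀(x)| ≤ 0.8` from
`6` on, close to the true amplitude `√(2/π)`. -/
theorem energy_six : normJ0' 6 ^ 2 + (1 + 1 / (4 * 6 ^ 2)) * normJ0 6 ^ 2 ≤ 0.64 := by
  have hF := besselF_neg_nine
  have hG := besselG_neg_nine
  simp only [normJ0', normJ0, besselJ0]
  norm_num only at hF hG ⊢
  set f := besselF (-9)
  set g := besselG (-9)
  rw [abs_le] at hF hG
  have hs : 0 < √6 := by positivity
  have h6 : √6 ^ 2 = 6 := Real.sq_sqrt (by norm_num)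
  have e1 : (f / (2 * √6) - √6 * (3 * g)) ^ 2 = f ^ 2 / 24 - 3 * f * g + 54 * g ^ 2 := by
    have : f / (2 * √6) = √6 * (f / 12) := by
      field_simp; rw [h6]; ring
    rw [this, ← mul_sub, mul_pow, h6]; ring
  rw [e1, mul_pow, h6]
  nlinarith

theorem normJ0_sq_add_sq_le {x : ℝ} (hx : 6 ≤ x) : normJ0' x ^ 2 + normJ0 x ^ 2 ≤ 0.64 := by
  have h := energy_antitoneOn (show (6 : ℝ) ∈ Set.Ioi 0 by norm_num)
    (show x ∈ Set.Ioi 0 from lt_of_lt_of_le (by norm_num) hx) hx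
  have h6 := energy_six
  have : 0 ≤ 1 / (4 * x ^ 2) * normJ0 x ^ 2 := by positivity
  simp only at h
  linarith

theorem abs_normJ0_le {x : ℝ} (hx : 6 ≤ x) : |normJ0 x| ≤ 0.8 :=
  abs_le_of_sq_le_sq (by nlinarith [normJ0_sq_add_sq_le hx, sq_nonneg (normJ0' x)]) (by norm_num)

/-- The point `u + i u'` for `u = √x J₀(x)`, in coordinates rotating with the phase `x`. -/
noncomputable def phaseJ0 (x : ℝ) : ℂ :=
  (normJ0 x + normJ0' x * Complex.I) * Complex.exp (x * Complex.I)

/-- The rotation removes the harmonic part of `u'' + u = -u/(4x²)`, so only the perturbation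
survives. Its size `O(x⁻²)` is integrable, whence the phase vector settles down. -/
theorem hasDerivAt_phaseJ0 {x : ℝ} (hx : 0 < x) :
    HasDerivAt phaseJ0
      (-((1 / (4 * x ^ 2) * normJ0 x : ℝ) * Complex.I) * Complex.exp (x * Complex.I)) x := by
  have h1 := (hasDerivAt_normJ0 hx).ofReal_comp
  have h2 := ((hasDerivAt_normJ0' hx).ofReal_comp).mul_const Complex.I
  have h3 : HasDerivAt (fun x : ℝ => Complex.exp (x * Complex.I))
      (Complex.exp (x * Complex.I) * (1 * Complex.I)) x :=
    ((hasDerivAt_id x).ofReal_comp.mul_const Complex.I).cexp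
  refine ((h1.add h2).mul h3).congr_deriv ?_
  simp only [Pi.add_apply]
  push_cast
  linear_combination (normJ0' x : ℂ) * Complex.exp (x * Complex.I) * Complex.I_sq

theorem norm_phaseJ0_sub_le {x y : ℝ} (hy : 6 ≤ y) (hxy : y ≤ x) :
    ‖phaseJ0 x - phaseJ0 y‖ ≤ 0.2 * (1 / y - 1 / x) := by
  have hB : ∀ t ∈ Set.Icc y x, HasDerivAt (fun t : ℝ => 0.2 * (1 / y - 1 / t))
      (0.2 * (1 / t ^ 2)) t := by
    intro t ht
    have ht0 : 0 < t := by linarith [ht.1]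
    have := (((hasDerivAt_inv ht0.ne').const_sub (1 / y)).const_mul 0.2)
    simp only [one_div] at this ⊢
    refine this.congr_deriv ?_
    simp
  have hf : ∀ t ∈ Set.Icc y x, HasDerivAt (fun t => phaseJ0 t - phaseJ0 y)
      (-((1 / (4 * t ^ 2) * normJ0 t : ℝ) * Complex.I) * Complex.exp (t * Complex.I)) t :=
    fun t ht => (hasDerivAt_phaseJ0 (by linarith [ht.1])).sub_const _
  refine image_norm_le_of_norm_deriv_right_le_deriv_boundary'
    (f := fun t => phaseJ0 t - phaseJ0 y) (a := y) (b := x)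
    (fun t ht => (hf t ht).continuousAt.continuousWithinAt)
    (fun t ht => (hf t (Set.Ico_subset_Icc_self ht)).hasDerivWithinAt)
    (B := fun t => 0.2 * (1 / y - 1 / t)) (B' := fun t => 0.2 * (1 / t ^ 2))
    (by simp) (fun t ht => (hB t ht).continuousAt.continuousWithinAt)
    (fun t ht => (hB t (Set.Ico_subset_Icc_self ht)).hasDerivWithinAt) (fun t ht => ?_)
    ⟨hxy, le_rfl⟩
  have ht0 : 0 < t := by linarith [ht.1]
  rw [norm_mul, Complex.norm_exp_ofReal_mul_I, mul_one, norm_neg, norm_mul, Complex.norm_I,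
    mul_one, Complex.norm_real, Real.norm_eq_abs, abs_mul, abs_of_nonneg (by positivity)]
  -- This is the origin of the constant `0.2 = 0.8/4`.
  calc 1 / (4 * t ^ 2) * |normJ0 t| ≤ 1 / (4 * t ^ 2) * 0.8 := by
        gcongr; exact abs_normJ0_le (by linarith [ht.1])
    _ = 0.2 * (1 / t ^ 2) := by field_simp; norm_num

theorem phaseJ0_mul_exp_neg (x t : ℝ) : phaseJ0 x * Complex.exp (-(t * Complex.I)) =
    (normJ0 x + normJ0' x * Complex.I) *
      (Real.cos (x - t) + Real.sin (x - t) * Complex.I) := by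
  rw [phaseJ0, mul_assoc, ← Complex.exp_add, Complex.ofReal_cos, Complex.ofReal_sin,
    ← Complex.exp_mul_I]
  congr 2
  push_cast; ring

/-- Rotate the phase estimate back by `e^{-iy}` and take real parts: up to the error, `u` is
continued from `x` to `y` as a solution of `u'' + u = 0`. -/
theorem abs_normJ0_sub_le {x y : ℝ} (hy : 6 ≤ y) (hxy : y ≤ x) :
    |normJ0 y - (normJ0 x * Real.cos (x - y) - normJ0' x * Real.sin (x - y))| ≤
      0.2 * (1 / y - 1 / x) := by
  refine le_trans ?_ (norm_phaseJ0_sub_le hy hxy)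
  have h : ‖(phaseJ0 y - phaseJ0 x) * Complex.exp (-(y * Complex.I))‖ =
      ‖phaseJ0 x - phaseJ0 y‖ := by
    rw [norm_mul, ← neg_mul, ← Complex.ofReal_neg, Complex.norm_exp_ofReal_mul_I, mul_one,
      norm_sub_rev]
  rw [← h]
  refine le_trans (le_of_eq ?_) (Complex.abs_re_le_norm _)
  rw [sub_mul, phaseJ0_mul_exp_neg, phaseJ0_mul_exp_neg, sub_self, Real.cos_zero, Real.sin_zero]
  congr 1
  simp [-Complex.ofReal_sub, -Complex.ofReal_cos, -Complex.ofReal_sin]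

/-- Useful when `x - y` is small. The first two terms come from `|sin δ| ≤ δ` and `1 - cos δ ≤ δ²/2`
in the harmonic continuation, the third from the phase error, the last from changing `1/√x` to
`1/√y`. -/
theorem abs_besselJ0_sub_le_of_near {x y p q : ℝ} (hy : 6 ≤ y) (hxy : y ≤ x)
    (hp : |normJ0 x| ≤ p) (hq : |normJ0' x| ≤ q) :
    |besselJ0 y - besselJ0 x| ≤
      (q * (x - y) + p * (x - y) ^ 2 / 2 + 0.2 * (1 / y - 1 / x) + p * (x - y) / (2 * y)) / √y := by
  have hy0 : 0 < y := by linarith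
  have hx0 : 0 < x := by linarith
  have hry : 0 < √y := Real.sqrt_pos.2 hy0
  have hrx : 0 < √x := Real.sqrt_pos.2 hx0
  have hrxy : √y ≤ √x := Real.sqrt_le_sqrt hxy
  have hp0 : 0 ≤ p := (abs_nonneg _).trans hp
  have hq0 : 0 ≤ q := (abs_nonneg _).trans hq
  have hδ : 0 ≤ x - y := sub_nonneg.2 hxy
  have h1 : |normJ0 y - normJ0 x| ≤ q * (x - y) + p * (x - y) ^ 2 / 2 + 0.2 * (1 / y - 1 / x) := by
    have e : normJ0 y - normJ0 x =
        (normJ0 y - (normJ0 x * Real.cos (x - y) - normJ0' x * Real.sin (x - y))) +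
        (-(normJ0 x * (1 - Real.cos (x - y))) + -(normJ0' x * Real.sin (x - y))) := by ring
    have hs : |normJ0' x * Real.sin (x - y)| ≤ q * (x - y) := by
      rw [abs_mul]
      have := Real.abs_sin_le_abs (x := x - y)
      rw [abs_of_nonneg hδ] at this
      gcongr
    have hc : |normJ0 x * (1 - Real.cos (x - y))| ≤ p * ((x - y) ^ 2 / 2) := by
      rw [abs_mul]
      have h1 := Real.one_sub_sq_div_two_le_cos (x := x - y)
      have h2 := Real.cos_le_one (x - y)
      rw [abs_of_nonneg (a := 1 - Real.cos (x - y)) (by linarith)]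
      gcongr
      linarith
    rw [e]
    refine (abs_add_le _ _).trans ?_
    have h2 := abs_add_le (-(normJ0 x * (1 - Real.cos (x - y))))
      (-(normJ0' x * Real.sin (x - y)))
    rw [abs_neg, abs_neg] at h2
    linarith [abs_normJ0_sub_le hy hxy]
  have h2 : |normJ0 x * (1 / √y - 1 / √x)| ≤ p * ((x - y) / (2 * y) / √y) := by
    have h0 : 0 ≤ 1 / √y - 1 / √x := sub_nonneg.2 (one_div_le_one_div_of_le hry hrxy)
    rw [abs_mul, abs_of_nonneg h0]
    gcongr
    have ey : √y ^ 2 = y := Real.sq_sqrt hy0.le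
    have ex : √x ^ 2 = x := Real.sq_sqrt hx0.le
    have e1 : 1 / √y - 1 / √x = (√x - √y) / (√x * √y) := by field_simp
    have e2 : x - y = (√x - √y) * (√x + √y) := by rw [← ex, ← ey]; simp; ring
    have h3 : 0 ≤ √x - √y := sub_nonneg.2 hrxy
    rw [e1, e2]
    rw [div_div, div_le_div_iff₀ (by positivity) (by positivity)]
    have h4 : 2 * y ≤ (√x + √y) * √x := by nlinarith
    have : (√x - √y) * (2 * y * √y) ≤ (√x - √y) * ((√x + √y) * √x * √y) := by gcongr
    linarith
  have e : besselJ0 y - besselJ0 x =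
      (normJ0 y - normJ0 x) / √y + normJ0 x * (1 / √y - 1 / √x) := by
    rw [besselJ0_eq hy0, besselJ0_eq hx0]; ring
  rw [e]
  refine (abs_add_le _ _).trans ?_
  rw [abs_div, abs_of_pos hry, add_div]
  refine add_le_add (by gcongr) (h2.trans (le_of_eq ?_))
  ring

theorem abs_besselJ0_le {x p : ℝ} (hx : 0 < x) (hp : |normJ0 x| ≤ p) :
    |besselJ0 x| ≤ p / √x := by
  rw [besselJ0_eq hx, abs_div, abs_of_nonneg (Real.sqrt_nonneg x)]
  gcongr

theorem abs_besselJ0_sub_le_of_far {x y p : ℝ} (hy : 6 ≤ y) (hxy : y ≤ x)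
    (hp : |normJ0 x| ≤ p) :
    |besselJ0 y - besselJ0 x| ≤ (0.8 + p) / √y := by
  have h1 := abs_besselJ0_le (by linarith) (abs_normJ0_le hy)
  have h2 := abs_besselJ0_le (by linarith) hp
  have hry : 0 < √y := Real.sqrt_pos.2 (by linarith)
  have h3 : p / √x ≤ p / √y := by
    have hp0 : 0 ≤ p := (abs_nonneg _).trans hp
    gcongr
  rw [add_div]
  linarith [abs_sub (besselJ0 y) (besselJ0 x)]

/-- The limit of the phase vector is `(1 + i)/√π` with `1/√π ≈ 0.5642`. One evaluation near `16π`
pins it down without proving asymptotics of `J₀`; the drift bound carries the value to every other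
point. -/
theorem norm_phaseJ0_far :
    ‖phaseJ0 (√(12633 / 5)) - 0.5642 * (1 + Complex.I)‖ ≤ 0.003 := by
  set x : ℝ := √(12633 / 5) with hx
  have hx2 : x ^ 2 = 12633 / 5 := Real.sq_sqrt (by norm_num)
  have hx0 : 0 ≤ x := Real.sqrt_nonneg _
  have hxl : 50.2652 ≤ x := by nlinarith
  have hxu : x ≤ 50.2654 := by nlinarith
  have hrl : 7.0897 ≤ √x := Real.le_sqrt_of_sq_le (by linarith)
  have hru : √x ≤ 7.0899 := Real.sqrt_le_iff.2 ⟨by norm_num, by linarith⟩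
  have hF := besselF_neg_far
  have hG := besselG_neg_far
  rw [abs_le] at hF hG
  have hz : -(x ^ 2 / 4) = -(12633 / 20) := by rw [hx2]; norm_num
  have hJ : besselJ0 x = besselF (-(12633 / 20)) := by rw [besselJ0, hz]
  set f := besselF (-(12633 / 20))
  set g := besselG (-(12633 / 20))
  have hu : |normJ0 x - 0.5642| ≤ 0.0017 := by
    rw [normJ0, hJ, abs_le]
    constructor <;> nlinarith
  have hv : |normJ0' x - 0.5642| ≤ 0.0019 := by
    rw [normJ0', hJ, hz]
    have h1 : f / (2 * √x) ≤ 0.00561 := by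
      rw [div_le_iff₀ (by linarith)]; linarith
    have h2 : 0.00558 ≤ f / (2 * √x) := by
      rw [le_div_iff₀ (by linarith)]; linarith
    have h3 : √x * (x / 2 * g) ≤ -0.5596 := by
      have : x / 2 * g ≤ -0.07896 := by nlinarith
      nlinarith
    have h4 : -0.5604 ≤ √x * (x / 2 * g) := by
      have : -0.07903 ≤ x / 2 * g := by nlinarith
      nlinarith
    rw [abs_le]
    constructor <;> linarith
  have hθ : |x - 16 * Real.pi| ≤ 0.0003 := by
    have h1 := Real.pi_gt_d6
    have h2 := Real.pi_lt_d6
    rw [abs_le]; constructor <;> linarith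
  have hexp : Complex.exp (x * Complex.I) = Complex.exp (Complex.I * ((x - 16 * Real.pi : ℝ))) := by
    rw [show (Complex.I * ((x - 16 * Real.pi : ℝ)) : ℂ) =
      x * Complex.I - (8 : ℤ) * (2 * Real.pi * Complex.I) by push_cast; ring,
      Complex.exp_sub, Complex.exp_int_mul_two_pi_mul_I, div_one]
  have hE : ‖Complex.exp (x * Complex.I) - 1‖ ≤ 0.0003 := by
    rw [hexp]
    exact (Real.norm_exp_I_mul_ofReal_sub_one_le).trans hθ
  have e : phaseJ0 x - 0.5642 * (1 + Complex.I) =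
      (((normJ0 x - 0.5642 : ℝ) : ℂ) + ((normJ0' x - 0.5642 : ℝ) : ℂ) * Complex.I) *
        Complex.exp (x * Complex.I) +
      0.5642 * (1 + Complex.I) * (Complex.exp (x * Complex.I) - 1) := by
    rw [phaseJ0]; push_cast; ring
  rw [e]
  refine (norm_add_le _ _).trans ?_
  rw [norm_mul, Complex.norm_exp_ofReal_mul_I, mul_one, Complex.norm_add_mul_I, norm_mul]
  have h1 : √((normJ0 x - 0.5642) ^ 2 + (normJ0' x - 0.5642) ^ 2) ≤ 0.0026 := by
    refine Real.sqrt_le_iff.2 ⟨by norm_num, ?_⟩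
    have := sq_le_sq' (abs_le.1 hu).1 (abs_le.1 hu).2
    have := sq_le_sq' (abs_le.1 hv).1 (abs_le.1 hv).2
    linarith
  have h2 : ‖(0.5642 * (1 + Complex.I) : ℂ)‖ ≤ 1.2 := by
    refine (norm_mul_le _ _).trans ?_
    have := norm_add_le (1 : ℂ) Complex.I
    rw [Complex.norm_I, norm_one] at this
    have h3 : ‖(0.5642 : ℂ)‖ = 0.5642 := by norm_num
    rw [h3]; linarith
  have h3 : ‖(0.5642 * (1 + Complex.I) : ℂ)‖ * ‖Complex.exp (x * Complex.I) - 1‖ ≤ 1.2 * 0.0003 := by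
    gcongr
  linarith

theorem norm_phaseJ0_sub_const_le {x : ℝ} (hx : 6 ≤ x) :
    ‖phaseJ0 x - 0.5642 * (1 + Complex.I)‖ ≤ 0.007 + 0.2 / x := by
  set y : ℝ := √(12633 / 5) with hy
  have hyl : 50 ≤ y := Real.le_sqrt_of_sq_le (by norm_num)
  have h0 := norm_phaseJ0_far
  have hx1 : 0 ≤ 0.2 / x := by positivity
  -- The constant `0.007` is the evaluation error `0.003` plus this drift.
  have hy1 : 0.2 / y ≤ 0.004 := by rw [div_le_iff₀ (by linarith)]; linarith
  have hy2 : 0 ≤ 0.2 / y := by positivity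
  have h : ‖phaseJ0 x - phaseJ0 y‖ ≤ 0.2 / x + 0.2 / y := by
    rcases le_total x y with hxy | hxy
    · rw [norm_sub_rev]
      refine (norm_phaseJ0_sub_le hx hxy).trans ?_
      rw [mul_sub, mul_one_div, mul_one_div]; linarith
    · refine (norm_phaseJ0_sub_le (by linarith) hxy).trans ?_
      rw [mul_sub, mul_one_div, mul_one_div]; linarith
  have := norm_sub_le_norm_sub_add_norm_sub (phaseJ0 x) (phaseJ0 y) (0.5642 * (1 + Complex.I))
  linarith

theorem abs_normJ0_le_phase {x : ℝ} (hx : 6 ≤ x) :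
    |normJ0 x| ≤ 0.5642 * |Real.cos x + Real.sin x| + (0.007 + 0.2 / x) ∧
    |normJ0' x| ≤ 0.5642 * |Real.cos x - Real.sin x| + (0.007 + 0.2 / x) := by
  have h := norm_phaseJ0_sub_const_le hx
  have h' : ‖(phaseJ0 x - 0.5642 * (1 + Complex.I)) * Complex.exp (-(x * Complex.I))‖ ≤
      0.007 + 0.2 / x := by
    rwa [norm_mul, ← neg_mul, ← Complex.ofReal_neg, Complex.norm_exp_ofReal_mul_I, mul_one]
  have e : (phaseJ0 x - 0.5642 * (1 + Complex.I)) * Complex.exp (-(x * Complex.I)) =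
      ((normJ0 x - 0.5642 * (Real.cos x + Real.sin x) : ℝ) : ℂ) +
      ((normJ0' x - 0.5642 * (Real.cos x - Real.sin x) : ℝ) : ℂ) * Complex.I := by
    rw [sub_mul, phaseJ0_mul_exp_neg, sub_self, Real.cos_zero, Real.sin_zero, ← neg_mul,
      ← Complex.ofReal_neg, Complex.exp_mul_I, ← Complex.ofReal_cos, ← Complex.ofReal_sin,
      Real.cos_neg, Real.sin_neg]
    push_cast
    linear_combination 0.5642 * Complex.sin x * Complex.I_sq
  rw [e] at h'
  constructor
  · have h1 := (Complex.abs_re_le_norm _).trans h'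
    simp only [Complex.add_re, Complex.ofReal_re, Complex.mul_re, Complex.I_re, mul_zero,
      Complex.ofReal_im, Complex.I_im, zero_mul, sub_zero, add_zero] at h1
    have h2 := abs_sub_abs_le_abs_sub (normJ0 x) (0.5642 * (Real.cos x + Real.sin x))
    rw [abs_mul, abs_of_pos (by norm_num : (0 : ℝ) < 0.5642)] at h2
    linarith
  · have h1 := (Complex.abs_im_le_norm _).trans h'
    simp only [Complex.add_im, Complex.ofReal_re, Complex.mul_im, Complex.I_re, mul_zero,
      Complex.ofReal_im, Complex.I_im, mul_one, add_zero, zero_add] at h1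
    have h2 := abs_sub_abs_le_abs_sub (normJ0' x) (0.5642 * (Real.cos x - Real.sin x))
    rw [abs_mul, abs_of_pos (by norm_num : (0 : ℝ) < 0.5642)] at h2
    linarith

/-! ### Telescoping majorants for power sums. -/

/-- Midpoint rule: a convex function is at most its mean over `[w - 1/2, w + 1/2]`. This and the
next two lemmas treat the exponents `-1/2`, `-3/2`, `-5/2`, with the antiderivative on the right. -/
theorem one_div_sqrt_le {w : ℝ} (hw : 1 / 2 < w) :
    1 / √w ≤ 2 * √(w + 1 / 2) - 2 * √(w - 1 / 2) := by
  have ha : 0 < √(w - 1 / 2) := Real.sqrt_pos.2 (by linarith)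
  have hc : 0 < √(w + 1 / 2) := Real.sqrt_pos.2 (by linarith)
  have hr : 0 < √w := Real.sqrt_pos.2 (by linarith)
  have ha2 : √(w - 1 / 2) ^ 2 = w - 1 / 2 := Real.sq_sqrt (by linarith)
  have hc2 : √(w + 1 / 2) ^ 2 = w + 1 / 2 := Real.sq_sqrt (by linarith)
  have hr2 : √w ^ 2 = w := Real.sq_sqrt (by linarith)
  set a := √(w - 1 / 2)
  set c := √(w + 1 / 2)
  set r := √w
  have h1 : a + c ≤ 2 * r := abs_le_of_sq_le_sq' (by nlinarith [sq_nonneg (a - c)]) (by linarith) |>.2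
  have e : 2 * c - 2 * a = 2 / (a + c) := by
    rw [eq_div_iff (by positivity)]; nlinarith
  rw [e, div_le_div_iff₀ hr (by positivity)]
  linarith

theorem one_div_mul_sqrt_le {w : ℝ} (hw : 1 / 2 < w) :
    1 / (w * √w) ≤ 2 / √(w - 1 / 2) - 2 / √(w + 1 / 2) := by
  have ha : 0 < √(w - 1 / 2) := Real.sqrt_pos.2 (by linarith)
  have hc : 0 < √(w + 1 / 2) := Real.sqrt_pos.2 (by linarith)
  have hr : 0 < √w := Real.sqrt_pos.2 (by linarith)
  have ha2 : √(w - 1 / 2) ^ 2 = w - 1 / 2 := Real.sq_sqrt (by linarith)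
  have hc2 : √(w + 1 / 2) ^ 2 = w + 1 / 2 := Real.sq_sqrt (by linarith)
  have hr2 : √w ^ 2 = w := Real.sq_sqrt (by linarith)
  set a := √(w - 1 / 2)
  set c := √(w + 1 / 2)
  set r := √w
  have h1 : a + c ≤ 2 * r := abs_le_of_sq_le_sq' (by nlinarith [sq_nonneg (a - c)]) (by linarith) |>.2
  have h2 : a * c ≤ w := by nlinarith [sq_nonneg (a - c)]
  have e : 2 / a - 2 / c = 2 / (a * c * (a + c)) := by
    field_simp; nlinarith
  rw [e, div_le_div_iff₀ (by positivity) (by positivity)]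
  have : a * c * (a + c) ≤ w * (2 * r) := by gcongr
  linarith

theorem one_div_sq_mul_sqrt_le {w : ℝ} (hw : 1 / 2 < w) :
    1 / (w ^ 2 * √w) ≤ 2 / 3 / √(w - 1 / 2) ^ 3 - 2 / 3 / √(w + 1 / 2) ^ 3 := by
  have ha : 0 < √(w - 1 / 2) := Real.sqrt_pos.2 (by linarith)
  have hc : 0 < √(w + 1 / 2) := Real.sqrt_pos.2 (by linarith)
  have hr : 0 < √w := Real.sqrt_pos.2 (by linarith)
  have ha2 : √(w - 1 / 2) ^ 2 = w - 1 / 2 := Real.sq_sqrt (by linarith)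
  have hc2 : √(w + 1 / 2) ^ 2 = w + 1 / 2 := Real.sq_sqrt (by linarith)
  have hr2 : √w ^ 2 = w := Real.sq_sqrt (by linarith)
  set a := √(w - 1 / 2)
  set c := √(w + 1 / 2)
  set r := √w
  have h1 : a + c ≤ 2 * r := abs_le_of_sq_le_sq' (by nlinarith [sq_nonneg (a - c)]) (by linarith) |>.2
  have h2 : a * c ≤ w := by nlinarith [sq_nonneg (a - c)]
  have hca : (c - a) * (a + c) = 1 := by nlinarith
  have e : 2 / 3 / a ^ 3 - 2 / 3 / c ^ 3 =
      2 / 3 * (a ^ 2 + a * c + c ^ 2) / ((a * c) ^ 3 * (a + c)) := by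
    rw [div_sub_div _ _ (by positivity) (by positivity), div_eq_div_iff (by positivity)
      (by positivity)]
    have : c ^ 3 - a ^ 3 = (c - a) * (a ^ 2 + a * c + c ^ 2) := by ring
    calc (2 / 3 * c ^ 3 - a ^ 3 * (2 / 3)) * ((a * c) ^ 3 * (a + c))
        = 2 / 3 * (c ^ 3 - a ^ 3) * ((a * c) ^ 3 * (a + c)) := by ring
      _ = 2 / 3 * (a ^ 2 + a * c + c ^ 2) * (a * c) ^ 3 * ((c - a) * (a + c)) := by
          rw [this]; ring
      _ = _ := by rw [hca]; ring
  have h3 : 2 / ((a * c) ^ 2 * (a + c)) ≤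
      2 / 3 * (a ^ 2 + a * c + c ^ 2) / ((a * c) ^ 3 * (a + c)) := by
    rw [div_le_div_iff₀ (by positivity) (by positivity)]
    have : 3 * (a * c) ≤ a ^ 2 + a * c + c ^ 2 := by nlinarith [sq_nonneg (a - c)]
    have h : (a * c) ^ 2 * (a + c) * (2 / 3) * (3 * (a * c)) ≤
      (a * c) ^ 2 * (a + c) * (2 / 3) * (a ^ 2 + a * c + c ^ 2) := by gcongr
    linarith
  rw [e]
  refine le_trans ?_ h3
  rw [div_le_div_iff₀ (by positivity) (by positivity)]
  have : (a * c) ^ 2 * (a + c) ≤ w ^ 2 * (2 * r) := by gcongr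
  linarith

theorem sum_Ico_le_sub {f g : ℕ → ℝ} {a b : ℕ} (hab : a ≤ b)
    (h : ∀ r, a ≤ r → f r ≤ g (r + 1) - g r) : ∑ r ∈ Finset.Ico a b, f r ≤ g b - g a := by
  induction b, hab using Nat.le_induction with
  | base => simp
  | succ n hn ih =>
    rw [Finset.sum_Ico_succ_top hn]
    linarith [h n hn]

/-! ### Sums of Bessel differences along `r ± s`. -/

/-- The difference of Bessel functions at `√((L t)² - (L b)²)` and `L t`. -/
noncomputable def besselDiff (L b t : ℝ) : ℝ :=
  besselJ0 √((L * t) ^ 2 - (L * b) ^ 2) - besselJ0 (L * t)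

theorem shift_le_sqrt {L b t : ℝ} (hL : 12.5 ≤ L) (hb : 0.6 ≤ b) (hb' : b ≤ 0.75)
    (ht : 1 + b ≤ t) : L * (t - 0.17) ≤ √((L * t) ^ 2 - (L * b) ^ 2) := by
  refine Real.le_sqrt_of_sq_le ?_
  -- The shift `0.17` is dictated by the worst case `b = 0.75`, `t = 1 + b`.
  have h1 : (t - 0.17) ^ 2 ≤ t ^ 2 - b ^ 2 := by nlinarith
  have h2 : L ^ 2 * (t - 0.17) ^ 2 ≤ L ^ 2 * (t ^ 2 - b ^ 2) := by gcongr
  linarith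

theorem sqrt_sub_sq_le {L b t : ℝ} (hL : 0 ≤ L) (ht : 0 ≤ t) :
    √((L * t) ^ 2 - (L * b) ^ 2) ≤ L * t :=
  Real.sqrt_le_iff.2 ⟨by positivity, by nlinarith [sq_nonneg (L * b)]⟩

theorem abs_besselDiff_le_far {L b t p : ℝ} (hL : 12.5 ≤ L) (hb : 0.6 ≤ b) (hb' : b ≤ 0.75)
    (ht : 1 + b ≤ t) (hp : |normJ0 (L * t)| ≤ p) :
    |besselDiff L b t| ≤ (0.8 + p) / √L * (1 / √(t - 0.17)) := by
  have h1 := shift_le_sqrt hL hb hb' ht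
  have h2 := sqrt_sub_sq_le (b := b) (by linarith : 0 ≤ L) (by linarith : 0 ≤ t)
  have hw : 0 < t - 0.17 := by linarith
  refine (abs_besselJ0_sub_le_of_far (by nlinarith) h2 hp).trans ?_
  have hp0 : 0 ≤ p := (abs_nonneg _).trans hp
  have h3 : √L * √(t - 0.17) ≤ √√((L * t) ^ 2 - (L * b) ^ 2) := by
    rw [← Real.sqrt_mul (by linarith)]; exact Real.sqrt_le_sqrt h1
  have : 0 < √L * √(t - 0.17) := mul_pos (Real.sqrt_pos.2 (by linarith)) (Real.sqrt_pos.2 hw)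
  calc _ ≤ (0.8 + p) / (√L * √(t - 0.17)) := by gcongr
    _ = _ := by field_simp

theorem abs_besselDiff_le_near {L b t p q : ℝ} (hL : 12.5 ≤ L) (hb : 0.6 ≤ b) (hb' : b ≤ 0.75)
    (ht : 1 + b ≤ t) (hp : |normJ0 (L * t)| ≤ p) (hq : |normJ0' (L * t)| ≤ q) (hp' : p ≤ 0.85) :
    |besselDiff L b t| ≤ (q * L * b ^ 2 / 2) / √L * (1 / ((t - 0.17) * √(t - 0.17))) +
      (p * L ^ 2 * b ^ 4 / 8 + 0.23 * b ^ 2) / √L * (1 / ((t - 0.17) ^ 2 * √(t - 0.17))) := by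
  have h1 := shift_le_sqrt hL hb hb' ht
  have h2 := sqrt_sub_sq_le (b := b) (by linarith : 0 ≤ L) (by linarith : 0 ≤ t)
  have hw : 1 < t - 0.17 := by linarith
  have hLp : 0 < L := by linarith
  have hp0 : 0 ≤ p := (abs_nonneg _).trans hp
  have hq0 : 0 ≤ q := (abs_nonneg _).trans hq
  have hy6 : 6 ≤ √((L * t) ^ 2 - (L * b) ^ 2) := by nlinarith
  refine (abs_besselJ0_sub_le_of_near hy6 h2 hp hq).trans ?_
  have h3 : √L * √(t - 0.17) ≤ √√((L * t) ^ 2 - (L * b) ^ 2) := by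
    rw [← Real.sqrt_mul (by linarith)]; exact Real.sqrt_le_sqrt h1
  have h4 : 0 < √L * √(t - 0.17) :=
    mul_pos (Real.sqrt_pos.2 (by linarith)) (Real.sqrt_pos.2 (by linarith))
  have hy2 : √((L * t) ^ 2 - (L * b) ^ 2) ^ 2 = (L * t) ^ 2 - (L * b) ^ 2 := by
    refine Real.sq_sqrt ?_
    have : L * b ≤ L * t := by gcongr; linarith
    nlinarith [show 0 ≤ L * b by positivity]
  set y := √((L * t) ^ 2 - (L * b) ^ 2)
  set w := t - 0.17 with hwdef
  have hδ0 : 0 ≤ L * t - y := by linarith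
  -- From `(Lt - y)(Lt + y) = L²b²` and `Lt + y ≥ 2Lw`.
  have hδ : L * t - y ≤ L * b ^ 2 / (2 * w) := by
    rw [le_div_iff₀ (by positivity)]
    have h5 : (L * t - y) * (L * (2 * w)) ≤ (L * t - y) * (L * t + y) := by
      gcongr
      nlinarith
    have h6 : L * ((L * t - y) * (2 * w)) ≤ L * (L * b ^ 2) := by nlinarith
    exact le_of_mul_le_mul_left h6 hLp
  have hδ2 : (L * t - y) ^ 2 ≤ (L * b ^ 2 / (2 * w)) ^ 2 := by gcongr
  have hy0 : 0 < y := by linarith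
  have hx0 : 0 < L * t := by linarith
  have herr : 0.2 * (1 / y - 1 / (L * t)) + p * (L * t - y) / (2 * y) ≤
      0.46 * ((L * b ^ 2 / (2 * w)) / (L * w)) := by
    have e1 : 1 / y - 1 / (L * t) = (L * t - y) / y * (1 / (L * t)) := by
      have ht0 : t ≠ 0 := by linarith
      field_simp
    have e2 : 1 / (L * t) ≤ 1 / 6 := one_div_le_one_div_of_le (by norm_num) (by linarith)
    have e3 : (L * t - y) / y ≤ (L * b ^ 2 / (2 * w)) / (L * w) := by gcongr
    have e4 : 0 ≤ (L * t - y) / y := by positivity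
    have e5 : p * (L * t - y) / (2 * y) = p / 2 * ((L * t - y) / y) := by field_simp
    rw [e1, e5]
    have e6 : (L * t - y) / y * (1 / (L * t)) ≤ (L * t - y) / y * (1 / 6) := by gcongr
    have e7 : p / 2 * ((L * t - y) / y) ≤ 0.85 / 2 * ((L * t - y) / y) := by gcongr
    linarith
  calc _ ≤ (q * (L * b ^ 2 / (2 * w)) + p * (L * b ^ 2 / (2 * w)) ^ 2 / 2 +
        0.46 * ((L * b ^ 2 / (2 * w)) / (L * w))) / (√L * √w) := by
        gcongr ?_ / ?_
        have e8 : q * (L * t - y) ≤ q * (L * b ^ 2 / (2 * w)) := by gcongr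
        have e9 : p * (L * t - y) ^ 2 / 2 ≤ p * (L * b ^ 2 / (2 * w)) ^ 2 / 2 := by gcongr
        linarith
    _ = _ := by
        have : 0 < √L := Real.sqrt_pos.2 hLp
        have : 0 < √w := Real.sqrt_pos.2 (by linarith)
        field_simp
        ring

theorem sum_abs_besselDiff_le {L b τ p q : ℝ} (hL : 12.5 ≤ L) (hb : 0.6 ≤ b) (hb' : b ≤ 0.75)
    (hτ : b - 1 ≤ τ) (hτ' : τ ≤ 1 - b) (hp : ∀ r : ℕ, 1 ≤ r → |normJ0 (L * (r + τ))| ≤ p)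
    (hq : ∀ r : ℕ, 1 ≤ r → |normJ0' (L * (r + τ))| ≤ q) (hp' : p ≤ 0.85) (K : ℕ) :
    ∑ r ∈ Finset.Ico 2 K, |besselDiff L b (r + τ)| ≤
      (0.8 + p) * (1.2 * b + 1 / (0.6 * b * L) - 2 * √(1.33 + τ) / √L) + q * b / 0.6 +
        0.3859 * p * b + 0.72 / (b * L ^ 2) := by
  have hp0 : 0 ≤ p := (abs_nonneg _).trans (hp 1 le_rfl)
  have hq0 : 0 ≤ q := (abs_nonneg _).trans (hq 1 le_rfl)
  have hLp : 0 < L := by linarith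
  have hbp : 0 < b := by linarith
  have hℓ : 0 < √L := Real.sqrt_pos.2 hLp
  have hℓ2 : √L ^ 2 = L := Real.sq_sqrt hLp.le
  set ℓ := √L with hℓdef
  -- With the cutoff near `g²`, the main contributions of both ranges become multiples of `b`,
  -- independent of `L`. The factor `0.6` balances them numerically.
  set g : ℝ := 0.6 * b * ℓ with hg
  have hg0 : 0 < g := by positivity
  have hg1 : 1.49 ≤ g ^ 2 := by
    have h : 0.36 ≤ b ^ 2 := by nlinarith
    have : g ^ 2 = 0.36 * b ^ 2 * L := by rw [hg, ← hℓ2]; ring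
    rw [this]; nlinarith
  -- Here `0.67 = 0.17 + 1/2` combines the shift in `shift_le_sqrt` with the half step of the
  -- midpoint rule; thus the telescoping argument at `R` lies in `[g², g² + 1]`.
  set R : ℕ := ⌈g ^ 2 - τ + 0.67⌉₊ with hR
  have hR1 : g ^ 2 ≤ R + τ - 0.67 := by
    have h := Nat.le_ceil (g ^ 2 - τ + 0.67)
    rw [← hR] at h; linarith
  have hR2 : R + τ - 0.67 ≤ g ^ 2 + 1 := by
    have h := Nat.ceil_lt_add_one (show 0 ≤ g ^ 2 - τ + 0.67 by linarith)
    rw [← hR] at h; linarith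
  have hR3 : 2 ≤ R := by
    have : (1 : ℝ) < R := by linarith
    have : 1 < R := by exact_mod_cast this
    omega
  have hcast : ∀ r : ℕ, 2 ≤ r → (2 : ℝ) ≤ r := fun r hr => by exact_mod_cast hr
  have hfar : ∑ r ∈ Finset.Ico 2 R, |besselDiff L b (r + τ)| ≤
      (0.8 + p) / ℓ * (2 * √(R + τ - 0.67)) - (0.8 + p) / ℓ * (2 * √(1.33 + τ)) := by
    have := sum_Ico_le_sub (f := fun r : ℕ => |besselDiff L b (r + τ)|)
      (g := fun r : ℕ => (0.8 + p) / ℓ * (2 * √(r + τ - 0.67))) hR3 (fun r hr => by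
        have hr' := hcast r hr
        refine (abs_besselDiff_le_far hL hb hb' (by linarith) (hp r (by omega))).trans ?_
        rw [← mul_sub]
        have h := one_div_sqrt_le (w := r + τ - 0.17) (by linarith)
        rw [show (r : ℝ) + τ - 0.17 + 1 / 2 = ((r + 1 : ℕ) : ℝ) + τ - 0.67 by push_cast; ring,
          show (r : ℝ) + τ - 0.17 - 1 / 2 = (r : ℝ) + τ - 0.67 by ring] at h
        gcongr)
    refine this.trans (le_of_eq ?_)
    rw [show ((2 : ℕ) : ℝ) + τ - 0.67 = 1.33 + τ by push_cast; ring]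
  set A := (q * L * b ^ 2 / 2) / ℓ with hA
  set B := (p * L ^ 2 * b ^ 4 / 8 + 0.23 * b ^ 2) / ℓ with hB
  have hA0 : 0 ≤ A := by positivity
  have hB0 : 0 ≤ B := by positivity
  have hnear : ∀ K', R ≤ K' → ∑ r ∈ Finset.Ico R K', |besselDiff L b (r + τ)| ≤
      A * (2 / √(R + τ - 0.67)) + B * (2 / 3 / √(R + τ - 0.67) ^ 3) := by
    intro K' hK'
    have := sum_Ico_le_sub (f := fun r : ℕ => |besselDiff L b (r + τ)|)
      (g := fun r : ℕ => -(A * (2 / √(r + τ - 0.67)) + B * (2 / 3 / √(r + τ - 0.67) ^ 3))) hK'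
      (fun r hr => by
        have hr' := hcast r (hR3.trans hr)
        have h0 := abs_besselDiff_le_near hL hb hb' (by linarith) (hp r (by omega))
          (hq r (by omega)) hp'
        rw [← hℓdef, ← hA, ← hB] at h0
        refine h0.trans ?_
        have h1 := one_div_mul_sqrt_le (w := r + τ - 0.17) (by linarith)
        have h2 := one_div_sq_mul_sqrt_le (w := r + τ - 0.17) (by linarith)
        rw [show (r : ℝ) + τ - 0.17 + 1 / 2 = ((r + 1 : ℕ) : ℝ) + τ - 0.67 by push_cast; ring,
          show (r : ℝ) + τ - 0.17 - 1 / 2 = (r : ℝ) + τ - 0.67 by ring] at h1 h2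
        have h1' := mul_le_mul_of_nonneg_left h1 hA0
        have h2' := mul_le_mul_of_nonneg_left h2 hB0
        linarith)
    refine this.trans ?_
    have : 0 ≤ A * (2 / √(K' + τ - 0.67)) + B * (2 / 3 / √(K' + τ - 0.67) ^ 3) := by positivity
    linarith
  have hW1 : g ≤ √(R + τ - 0.67) := Real.le_sqrt_of_sq_le hR1
  have hW2 : √(R + τ - 0.67) ≤ g + 1 / (2 * g) := by
    refine Real.sqrt_le_iff.2 ⟨by positivity, hR2.trans ?_⟩
    have : (g + 1 / (2 * g)) ^ 2 = g ^ 2 + 1 + (1 / (2 * g)) ^ 2 := by field_simp; ring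
    rw [this]; linarith [sq_nonneg (1 / (2 * g))]
  calc ∑ r ∈ Finset.Ico 2 K, |besselDiff L b (r + τ)|
      ≤ ∑ r ∈ Finset.Ico 2 (max K R), |besselDiff L b (r + τ)| :=
        Finset.sum_le_sum_of_subset_of_nonneg
          (Finset.Ico_subset_Ico le_rfl (le_max_left _ _)) fun _ _ _ => abs_nonneg _
    _ = ∑ r ∈ Finset.Ico 2 R, |besselDiff L b (r + τ)| +
        ∑ r ∈ Finset.Ico R (max K R), |besselDiff L b (r + τ)| :=
        (Finset.sum_Ico_consecutive _ hR3 (le_max_right _ _)).symm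
    _ ≤ ((0.8 + p) / ℓ * (2 * √(R + τ - 0.67)) - (0.8 + p) / ℓ * (2 * √(1.33 + τ))) +
        (A * (2 / √(R + τ - 0.67)) + B * (2 / 3 / √(R + τ - 0.67) ^ 3)) :=
        add_le_add hfar (hnear _ (le_max_right _ _))
    _ ≤ ((0.8 + p) / ℓ * (2 * (g + 1 / (2 * g))) - (0.8 + p) / ℓ * (2 * √(1.33 + τ))) +
        (A * (2 / g) + B * (2 / 3 / g ^ 3)) := by gcongr
    _ ≤ _ := by
        have e1 : (0.8 + p) / ℓ * (2 * (g + 1 / (2 * g))) =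
            (0.8 + p) * (1.2 * b + 1 / (0.6 * b * L)) := by
          rw [hg, ← hℓ2]; field_simp; ring
        have e2 : A * (2 / g) = q * b / 0.6 := by
          rw [hA, hg, ← hℓ2]; field_simp
        have e3 : B * (2 / 3 / g ^ 3) = p * b / 2.592 + 0.46 / 0.648 / (b * L ^ 2) := by
          rw [hB, hg, ← hℓ2]; field_simp; ring
        have e4 : p * b / 2.592 ≤ 0.3859 * p * b := by
          have : 0 ≤ p * b := by positivity
          rw [div_le_iff₀ (by norm_num)]; linarith
        have e5 : 0.46 / 0.648 / (b * L ^ 2) ≤ 0.72 / (b * L ^ 2) := by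
          gcongr; norm_num
        rw [e1, e2, e3]
        have e6 : (0.8 + p) / ℓ * (2 * √(1.33 + τ)) = (0.8 + p) * (2 * √(1.33 + τ) / ℓ) := by ring
        rw [e6]
        linarith

/-- The terms `r = ±1` are separate because at `1 - s` the square root may vanish; there only `|J₀|
≤ 1` is available. The other three Bessel values are `O(L^(-1/2))`. -/
theorem first_terms_le {L b s p q : ℝ} (hL : 12.5 ≤ L) (hb : 0.6 ≤ b) (hb' : b ≤ 0.75)
    (hs : 0 ≤ s) (hs' : s ≤ 1 - b) (hJ : ∀ x, |besselJ0 x| ≤ 1)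
    (hp : |normJ0 (L * (1 - s))| ≤ p) (hq : |normJ0 (L * (1 + s))| ≤ q) :
    |besselDiff L b (1 - s)| + |besselDiff L b (1 + s)| ≤
      1 + (0.985 + 1.292 * (p + q)) / √L := by
  have hp0 : 0 ≤ p := (abs_nonneg _).trans hp
  have hq0 : 0 ≤ q := (abs_nonneg _).trans hq
  have hℓ : 0 < √L := Real.sqrt_pos.2 (by linarith)
  have h1 : |besselDiff L b (1 - s)| ≤ 1 + 1.292 * p / √L := by
    refine (abs_sub _ _).trans (add_le_add (hJ _) ?_)
    refine (abs_besselJ0_le (by nlinarith) hp).trans ?_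
    have : 0.774 * √L ≤ √(L * (1 - s)) := by
      refine Real.le_sqrt_of_sq_le ?_
      rw [mul_pow, Real.sq_sqrt (by linarith)]
      nlinarith
    calc p / √(L * (1 - s)) ≤ p / (0.774 * √L) := by gcongr
      _ = (1 / 0.774) * (p / √L) := by field_simp
      _ ≤ 1.292 * (p / √L) := by gcongr; norm_num
      _ = _ := by ring
  have h2 : |besselDiff L b (1 + s)| ≤ (0.985 + 1.292 * q) / √L := by
    have hy : L * 0.661 ≤ √((L * (1 + s)) ^ 2 - (L * b) ^ 2) := by
      refine Real.le_sqrt_of_sq_le ?_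
      have : (0.661 : ℝ) ^ 2 ≤ (1 + s) ^ 2 - b ^ 2 := by nlinarith
      have := mul_le_mul_of_nonneg_left this (sq_nonneg L)
      linarith
    refine (abs_sub _ _).trans ?_
    rw [add_div]
    refine add_le_add ?_ ?_
    · have hy6 : 6 ≤ √((L * (1 + s)) ^ 2 - (L * b) ^ 2) := by linarith
      refine (abs_besselJ0_le (by linarith) (abs_normJ0_le hy6)).trans ?_
      have : 0.813 * √L ≤ √√((L * (1 + s)) ^ 2 - (L * b) ^ 2) := by
        refine Real.le_sqrt_of_sq_le ?_
        rw [mul_pow, Real.sq_sqrt (by linarith)]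
        linarith
      calc _ ≤ 0.8 / (0.813 * √L) := by gcongr
        _ = 0.8 / 0.813 / √L := by field_simp
        _ ≤ _ := by gcongr; norm_num
    · refine (abs_besselJ0_le (by nlinarith) hq).trans ?_
      have : √L ≤ √(L * (1 + s)) := Real.sqrt_le_sqrt (by nlinarith)
      calc _ ≤ q / √L := by gcongr
        _ ≤ _ := by gcongr; linarith
  rw [add_div, mul_add, add_div]
  rw [add_div] at h2
  linarith

/-- The final numerical inequality, with `i = 1/b`, `l = 1/√L` and `T` in the role of `p + q`. -/
theorem alias_constant_le {b i l T : ℝ} (hb : 0.6 ≤ b) (hb' : b ≤ 0.75) (hi : i * b = 1)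
    (hl : 0 ≤ l) (hl' : l ≤ 0.2822) (hT : T ≤ 1.1424 + 0.67 * l ^ 2) :
    1 + 1.92 * b + 2.667 * i * l ^ 2 - 2.661 * l +
      T * (3.2526 * b + 1.667 * i * l ^ 2 - 0.636 * l) + 1.44 * i * l ^ 4 ≤ 5.25 - 3 * l ^ 2 := by
  have hi0 : 0 < i := by
    by_contra h
    nlinarith
  -- A rounded chord of the convex function `1/b` over `[0.6, 0.75]`.
  have hi1 : i ≤ 3 - 2.222 * b := by
    have h : i * (3 - 2.222 * b) * b = 3 - 2.222 * b := by linear_combination (3 - 2.222 * b) * hi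
    by_contra hc
    push Not at hc
    nlinarith [mul_nonneg (sub_nonneg.2 hb) (sub_nonneg.2 hb')]
  have hcoef : 0 ≤ 3.2526 * b + 1.667 * i * l ^ 2 - 0.636 * l := by
    have : 0 ≤ i * l ^ 2 := by positivity
    nlinarith
  have h2 : l ^ 2 ≤ 0.2822 * l := by nlinarith
  have h3 : l ^ 4 ≤ 0.0226 * l := by
    have : l ^ 4 ≤ (0.2822 * l) ^ 2 := by
      calc l ^ 4 = (l ^ 2) ^ 2 := by ring
        _ ≤ _ := by gcongr
    nlinarith
  have h3' : 0 ≤ l ^ 3 := by positivity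
  have hTm := mul_le_mul_of_nonneg_right hT hcoef
  have e2 : i * l ^ 2 ≤ 0.2822 * (i * l) := by nlinarith
  have e4 : i * l ^ 4 ≤ 0.0226 * (i * l) := by nlinarith
  have ei : i * l ≤ (3 - 2.222 * b) * l := by gcongr
  have eb : b * l ^ 2 ≤ 0.2822 * (b * l) := by nlinarith
  have expand : (1.1424 + 0.67 * l ^ 2) * (3.2526 * b + 1.667 * i * l ^ 2 - 0.636 * l) =
    1.1424 * 3.2526 * b + 1.1424 * 1.667 * (i * l ^ 2) - 1.1424 * 0.636 * l +
    0.67 * 3.2526 * (b * l ^ 2) + 0.67 * 1.667 * (i * l ^ 4) - 0.67 * 0.636 * l ^ 3 := by ring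
  rw [expand] at hTm
  -- The tight case is `b = 0.75`, that is `σ = 2`, as `l → 0`: the left side is then `5.227`.
  have main : 1 + 5.636 * b + l * (1.502 - 2.377 * b) ≤ 5.25 := by nlinarith
  nlinarith

/-- On each of the two half-lines `L (r ∓ s)` the phases of `√x J₀(x)` are constant, and they are
complementary to each other. -/
theorem exists_phase_bounds {m : ℕ} (hm : 2 ≤ m) {b s : ℝ} (hb : 0.6 ≤ b) (hs : 0 ≤ s)
    (hs' : s ≤ 1 - b) : ∃ p q : ℝ, p ≤ 0.85 ∧ q ≤ 0.85 ∧
      p + q ≤ 1.1424 + 0.67 / (2 * Real.pi * m) ∧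
      (∀ r : ℕ, 1 ≤ r → |normJ0 (2 * Real.pi * m * (r + -s))| ≤ p ∧
        |normJ0' (2 * Real.pi * m * (r + -s))| ≤ q) ∧
      (∀ r : ℕ, 1 ≤ r → |normJ0 (2 * Real.pi * m * (r + s))| ≤ q ∧
        |normJ0' (2 * Real.pi * m * (r + s))| ≤ p) := by
  have hm' : (2 : ℝ) ≤ m := by exact_mod_cast hm
  have hpi := Real.pi_gt_d6
  have hL : 12.566 ≤ 2 * Real.pi * m := by nlinarith
  -- Integrality of `m` enters here: shifting by `r` changes the phase by `mr` full turns.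
  have hcos : ∀ r : ℕ, ∀ t, Real.cos (2 * Real.pi * m * (r + t)) = Real.cos (2 * Real.pi * m * t) :=
    fun r t => by
      rw [show 2 * Real.pi * m * (r + t) = 2 * Real.pi * m * t + ((m * r : ℕ) : ℝ) * (2 * Real.pi) by
        push_cast; ring]
      exact Real.cos_add_nat_mul_two_pi _ _
  have hsin : ∀ r : ℕ, ∀ t, Real.sin (2 * Real.pi * m * (r + t)) = Real.sin (2 * Real.pi * m * t) :=
    fun r t => by
      rw [show 2 * Real.pi * m * (r + t) = 2 * Real.pi * m * t + ((m * r : ℕ) : ℝ) * (2 * Real.pi) by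
        push_cast; ring]
      exact Real.sin_add_nat_mul_two_pi _ _
  set L := 2 * Real.pi * m with hLdef
  have hL0 : 0 < L := by linarith
  set C := Real.cos (L * s)
  set S := Real.sin (L * s)
  set p := 0.5642 * |C - S| + (0.007 + 0.335 / L) with hpdef
  set q := 0.5642 * |C + S| + (0.007 + 0.335 / L) with hqdef
  have hCS : C ^ 2 + S ^ 2 = 1 := Real.cos_sq_add_sin_sq _
  have hbound : ∀ r : ℕ, 1 ≤ r → ∀ t, b - 1 ≤ t →
      |normJ0 (L * (r + t))| ≤ 0.5642 * |Real.cos (L * t) + Real.sin (L * t)| +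
        (0.007 + 0.335 / L) ∧
      |normJ0' (L * (r + t))| ≤ 0.5642 * |Real.cos (L * t) - Real.sin (L * t)| +
        (0.007 + 0.335 / L) := by
    intro r hr t ht
    have hr' : (1 : ℝ) ≤ r := by exact_mod_cast hr
    have h1 : L * 0.6 ≤ L * (r + t) := by gcongr; linarith
    have h := abs_normJ0_le_phase (x := L * (r + t)) (by linarith)
    rw [hcos, hsin] at h
    have h2 : 0.2 / (L * (r + t)) ≤ 0.335 / L := by
      calc _ ≤ 0.2 / (L * 0.6) := by gcongr
        _ = 0.2 / 0.6 / L := by field_simp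
        _ ≤ _ := by gcongr; norm_num
    exact ⟨by linarith [h.1], by linarith [h.2]⟩
  have hneg : ∀ r : ℕ, 1 ≤ r → |normJ0 (L * (r + -s))| ≤ p ∧ |normJ0' (L * (r + -s))| ≤ q := by
    intro r hr
    have h := hbound r hr (-s) (by linarith)
    rw [mul_neg, Real.cos_neg, Real.sin_neg, sub_neg_eq_add, ← sub_eq_add_neg] at h
    exact h
  have hpos : ∀ r : ℕ, 1 ≤ r → |normJ0 (L * (r + s))| ≤ q ∧ |normJ0' (L * (r + s))| ≤ p :=
    fun r hr => hbound r hr s (by linarith)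
  have hLi : 0.335 / L ≤ 0.03 := by rw [div_le_iff₀ hL0]; linarith
  have hLi0 : 0 ≤ 0.335 / L := by positivity
  have hp1 : p ≤ 0.85 := by
    have : |C - S| ≤ 1.415 := abs_le_of_sq_le_sq (by nlinarith [sq_nonneg (C + S)]) (by norm_num)
    linarith
  have hq1 : q ≤ 0.85 := by
    have : |C + S| ≤ 1.415 := abs_le_of_sq_le_sq (by nlinarith [sq_nonneg (C - S)]) (by norm_num)
    linarith
  have hpq : p + q ≤ 1.1424 + 0.67 / L := by
    have h1 := Real.abs_cos_le_one (L * s)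
    have h2 := Real.abs_sin_le_one (L * s)
    -- The sum equals `2 max(|C|, |S|)`. Bounding the two terms separately would only give `2√2`,
    -- too much for the constant.
    have h3 : |C - S| + |C + S| ≤ 2 := by
      rw [abs_le] at h1 h2
      rcases abs_cases (C - S) with h | h <;> rcases abs_cases (C + S) with h' | h' <;>
        linarith [h1.1, h1.2, h2.1, h2.2]
    have h4 : 0.67 / L = 2 * (0.335 / L) := by ring
    rw [h4]; linarith
  exact ⟨p, q, hp1, hq1, hpq, hneg, hpos⟩

/-- These are the lower boundary terms of the telescoping sums, `1.33 = 2 - 0.67`. All three bounds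
are extremal at `s = 0.4`; the joint one beats twice the separate one. -/
theorem sqrt_shift_bounds {s : ℝ} (hs : 0 ≤ s) (hs' : s ≤ 0.4) :
    0.964 ≤ √(1.33 + -s) ∧ 0.964 ≤ √(1.33 + s) ∧ 2.279 ≤ √(1.33 + -s) + √(1.33 + s) := by
  have e1 : √(1.33 + -s) ^ 2 = 1.33 + -s := Real.sq_sqrt (by linarith)
  have e2 : √(1.33 + s) ^ 2 = 1.33 + s := Real.sq_sqrt (by linarith)
  have e3 : 1.2684 ≤ √(1.33 + -s) * √(1.33 + s) := by
    rw [← Real.sqrt_mul (by linarith)]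
    exact Real.le_sqrt_of_sq_le (by nlinarith)
  refine ⟨Real.le_sqrt_of_sq_le (by norm_num; linarith),
    Real.le_sqrt_of_sq_le (by norm_num; linarith), ?_⟩
  refine le_of_sq_le_sq ?_ (by positivity)
  nlinarith

theorem alias_terms_le {L b s p q X Y Z : ℝ} (hL : 12.566 ≤ L) (hb : 0.6 ≤ b) (hb' : b ≤ 0.75)
    (hs : 0 ≤ s) (hs' : s ≤ 1 - b) (hp0 : 0 ≤ p) (hq0 : 0 ≤ q)
    (hpq : p + q ≤ 1.1424 + 0.67 / L)
    (hX : X ≤ 1 + (0.985 + 1.292 * (p + q)) / √L)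
    (hY : Y ≤ (0.8 + p) * (1.2 * b + 1 / (0.6 * b * L) - 2 * √(1.33 + -s) / √L) + q * b / 0.6 +
        0.3859 * p * b + 0.72 / (b * L ^ 2))
    (hZ : Z ≤ (0.8 + q) * (1.2 * b + 1 / (0.6 * b * L) - 2 * √(1.33 + s) / √L) + p * b / 0.6 +
        0.3859 * q * b + 0.72 / (b * L ^ 2)) :
    X + (Y + Z) ≤ 5.25 - 3 / L := by
  have hL0 : 0 < L := by linarith
  have hℓ : 0 < √L := Real.sqrt_pos.2 hL0
  have hℓ2 : √L ^ 2 = L := Real.sq_sqrt hL0.le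
  have hb0 : 0 < b := by linarith
  obtain ⟨hr1, hr2, hr3⟩ := sqrt_shift_bounds hs (by linarith)
  generalize √(1.33 + -s) = u at *
  generalize √(1.33 + s) = v at *
  obtain ⟨l, hl⟩ : ∃ l, l = 1 / √L := ⟨_, rfl⟩
  have hl0 : 0 < l := by rw [hl]; positivity
  have hl2 : 1 / L = l ^ 2 := by rw [hl, div_pow, hℓ2, one_pow]
  have hl1 : l ≤ 0.2822 := by
    rw [hl, div_le_iff₀ hℓ]
    have : 3.5448 ≤ √L := Real.le_sqrt_of_sq_le (by norm_num; linarith)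
    linarith
  have hpq' : p + q ≤ 1.1424 + 0.67 * l ^ 2 := by
    rw [← hl2]; linarith [show 0.67 / L = 0.67 * (1 / L) by ring]
  have key := alias_constant_le hb hb' (i := 1 / b) (by field_simp) hl0.le hl1 hpq'
  have e1 : 1 / (0.6 * b * L) = (1 / 0.6) * ((1 / b) * l ^ 2) := by rw [← hl2]; field_simp
  have e2 : 0.72 / (b * L ^ 2) = 0.72 * ((1 / b) * l ^ 4) := by
    rw [show l ^ 4 = (l ^ 2) ^ 2 by ring, ← hl2]; field_simp
  have e3 : ∀ t, t / √L = t * l := fun t => by rw [hl]; ring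
  have e4 : 3 / L = 3 * l ^ 2 := by rw [← hl2]; ring
  rw [e1, e2, e3] at hY hZ
  rw [e3] at hX
  rw [e4]
  have hi0 : 0 < 1 / b := by positivity
  generalize 1 / b = i at *
  have f1 : 2.279 * l ≤ (u + v) * l := by gcongr
  have f2 : 0.964 * (p * l) ≤ u * (p * l) := by gcongr
  have f3 : 0.964 * (q * l) ≤ v * (q * l) := by gcongr
  have f4 : 0 ≤ (p + q) * (i * l ^ 2) := by positivity
  have f5 : 0 ≤ (p + q) * b := by positivity
  have f6 : 0 ≤ i * l ^ 2 := by positivity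
  ring_nf at hX hZ hY key f1 f2 f3 f4 f5 f6 ⊢
  linarith

theorem sum_besselDiff_le {m : ℕ} (hm : 2 ≤ m) {b s : ℝ} (hb : 0.6 ≤ b) (hb' : b ≤ 0.75)
    (hs : 0 ≤ s) (hs' : s ≤ 1 - b) (hJ : ∀ x, |besselJ0 x| ≤ 1) (K : ℕ) :
    ∑ r ∈ Finset.Ico 1 K, (|besselDiff (2 * Real.pi * m) b (r - s)| +
        |besselDiff (2 * Real.pi * m) b (r + s)|) ≤
      5.25 - 3 / (2 * Real.pi * m) := by
  have hm' : (2 : ℝ) ≤ m := by exact_mod_cast hm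
  have hpi := Real.pi_gt_d6
  have hL : 12.566 ≤ 2 * Real.pi * m := by nlinarith
  obtain ⟨p, q, hp1, hq1, hpq, hneg, hpos⟩ := exists_phase_bounds hm hb hs hs'
  have hp0 : 0 ≤ p := (abs_nonneg _).trans (hneg 1 le_rfl).1
  have hq0 : 0 ≤ q := (abs_nonneg _).trans (hneg 1 le_rfl).2
  generalize 2 * Real.pi * m = L at *
  have hA := sum_abs_besselDiff_le (by linarith : (12.5 : ℝ) ≤ L) hb hb' (τ := -s) (by linarith)
    (by linarith) (fun r hr => (hneg r hr).1) (fun r hr => (hneg r hr).2) hp1 (max 2 K)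
  have hB := sum_abs_besselDiff_le (by linarith : (12.5 : ℝ) ≤ L) hb hb' (τ := s) (by linarith)
    (by linarith) (fun r hr => (hpos r hr).1) (fun r hr => (hpos r hr).2) hq1 (max 2 K)
  have h1 := first_terms_le (by linarith : (12.5 : ℝ) ≤ L) hb hb' hs hs' hJ
    (by simpa [sub_eq_add_neg] using (hneg 1 le_rfl).1) (by simpa using (hpos 1 le_rfl).1)
  have hsum : ∑ r ∈ Finset.Ico 1 K, (|besselDiff L b (r - s)| + |besselDiff L b (r + s)|) ≤
      (|besselDiff L b (1 - s)| + |besselDiff L b (1 + s)|) +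
      (∑ r ∈ Finset.Ico 2 (max 2 K), |besselDiff L b (r + -s)| +
        ∑ r ∈ Finset.Ico 2 (max 2 K), |besselDiff L b (r + s)|) := by
    rw [← Finset.sum_add_distrib]
    refine (Finset.sum_le_sum_of_subset_of_nonneg
      (Finset.Ico_subset_Ico le_rfl (le_max_right 2 K))
      fun _ _ _ => add_nonneg (abs_nonneg _) (abs_nonneg _)).trans ?_
    rw [Finset.sum_eq_sum_Ico_succ_bot (by omega)]
    simp [sub_eq_add_neg]
  exact hsum.trans (alias_terms_le hL hb hb' hs hs' hp0 hq0 hpq h1 hA hB)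

/-! ### Integral representations of the Bessel functions. -/

theorem hasSum_integral_pow_div_factorial_mul {h c : ℝ → ℂ} (hh : Continuous h)
    (hc : Continuous c) {M : ℝ} (hM : ∀ t, ‖h t‖ ≤ M) (a b : ℝ) :
    HasSum (fun k : ℕ => ∫ t in a..b, h t ^ k / (k.factorial : ℂ) * c t)
      (∫ t in a..b, Complex.exp (h t) * c t) := by
  refine intervalIntegral.hasSum_integral_of_dominated_convergence
    (fun (k : ℕ) t => M ^ k / k.factorial * ‖c t‖) (fun k => ?_) (fun k => ?_) ?_ ?_ ?_
  · exact (((hh.pow k).div_const _).mul hc).aestronglyMeasurable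
  · refine Filter.Eventually.of_forall fun t _ => ?_
    rw [norm_mul, norm_div, norm_pow, Complex.norm_natCast]
    gcongr
    exact hM t
  · exact Filter.Eventually.of_forall fun t _ =>
      (Real.summable_pow_div_factorial M).mul_right _
  · simp_rw [tsum_mul_right]
    exact (hc.norm.const_mul _).intervalIntegrable _ _
  · refine Filter.Eventually.of_forall fun t _ => ?_
    have := NormedSpace.expSeries_div_hasSum_exp (h t)
    rw [← Complex.exp_eq_exp_ℂ] at this
    exact this.mul_right _

theorem integral_exp_int_mul_I (n : ℤ) (hn : n ≠ 0) (a : ℝ) :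
    ∫ t in a..(a + 2 * Real.pi), Complex.exp (n * (t * Complex.I)) = 0 := by
  have hn' : (n : ℂ) * Complex.I ≠ 0 := mul_ne_zero (by exact_mod_cast hn) Complex.I_ne_zero
  have h := integral_exp_mul_complex (a := a) (b := a + 2 * Real.pi) hn'
  have e : (n : ℂ) * Complex.I * ((a + 2 * Real.pi : ℝ) : ℂ) =
      n * Complex.I * a + n * (2 * Real.pi * Complex.I) := by push_cast; ring
  rw [e, Complex.exp_add, Complex.exp_int_mul_two_pi_mul_I, mul_one, sub_self, zero_div] at h
  rw [← h]
  congr 1; ext t; congr 1; ring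

theorem continuous_mul_exp_mul_I (z w : ℂ) :
    Continuous fun t : ℝ => z * Complex.exp (w * (t * Complex.I)) := by fun_prop

theorem norm_mul_exp_neg_le (z : ℂ) (t : ℝ) : ‖z * Complex.exp (-1 * (t * Complex.I))‖ ≤ ‖z‖ := by
  rw [norm_mul, show (-1 : ℂ) * (t * Complex.I) = ((-t : ℝ) : ℂ) * Complex.I by push_cast; ring,
    Complex.norm_exp_ofReal_mul_I, mul_one]

theorem norm_mul_exp_le (z : ℂ) (t : ℝ) : ‖z * Complex.exp (1 * (t * Complex.I))‖ ≤ ‖z‖ := by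
  rw [norm_mul, one_mul, Complex.norm_exp_ofReal_mul_I, mul_one]

theorem integral_exp_mul_exp_exp_neg (B : ℂ) (k : ℕ) (a : ℝ) :
    ∫ t in a..(a + 2 * Real.pi), Complex.exp (B * Complex.exp (-1 * (t * Complex.I))) *
      Complex.exp (k * (t * Complex.I)) = 2 * Real.pi * (B ^ k / (k.factorial : ℂ)) := by
  have h := hasSum_integral_pow_div_factorial_mul (continuous_mul_exp_mul_I B (-1))
    (c := fun t : ℝ => Complex.exp (k * (t * Complex.I))) (by fun_prop)
    (norm_mul_exp_neg_le B) a (a + 2 * Real.pi)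
  refine h.unique ?_
  have e : ∀ j : ℕ, ∫ t in a..(a + 2 * Real.pi), (B * Complex.exp (-1 * (t * Complex.I))) ^ j /
      (j.factorial : ℂ) * Complex.exp (k * (t * Complex.I)) =
      B ^ j / j.factorial * ∫ t in a..(a + 2 * Real.pi),
        Complex.exp (((k : ℤ) - (j : ℤ) : ℤ) * (t * Complex.I)) := by
    intro j
    rw [← intervalIntegral.integral_const_mul]
    congr 1; ext t
    rw [mul_pow, ← Complex.exp_nat_mul]
    have : Complex.exp (((k : ℤ) - (j : ℤ) : ℤ) * (t * Complex.I)) =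
        Complex.exp (j * (-1 * (t * Complex.I))) * Complex.exp (k * (t * Complex.I)) := by
      rw [← Complex.exp_add]; congr 1; push_cast; ring
    rw [this]; ring
  simp_rw [e]
  convert hasSum_single k fun j hj => ?_ using 1
  · simp [mul_comm]
  · rw [integral_exp_int_mul_I _ (by omega), mul_zero]

/-- Expanding both exponentials, orthogonality over a period keeps only the constant Fourier
coefficient, with terms `A^k B^k/(k!)²`. -/
theorem integral_exp_mul_exp (A B : ℂ) (a : ℝ) :
    HasSum (fun k : ℕ => 2 * Real.pi * ((A * B) ^ k / (k.factorial : ℂ) ^ 2))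
      (∫ t in a..(a + 2 * Real.pi), Complex.exp (A * Complex.exp (1 * (t * Complex.I))) *
        Complex.exp (B * Complex.exp (-1 * (t * Complex.I)))) := by
  have h := hasSum_integral_pow_div_factorial_mul (continuous_mul_exp_mul_I A 1)
    (c := fun t : ℝ => Complex.exp (B * Complex.exp (-1 * (t * Complex.I)))) (by fun_prop)
    (norm_mul_exp_le A) a (a + 2 * Real.pi)
  refine h.congr_fun fun k => ?_
  have e : ∀ t : ℝ, (A * Complex.exp (1 * (t * Complex.I))) ^ k / (k.factorial : ℂ) *
      Complex.exp (B * Complex.exp (-1 * (t * Complex.I))) =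
      A ^ k / k.factorial * (Complex.exp (B * Complex.exp (-1 * (t * Complex.I))) *
      Complex.exp (k * (t * Complex.I))) := by
    intro t
    rw [mul_pow, ← Complex.exp_nat_mul, one_mul]; ring
  simp_rw [e]
  rw [intervalIntegral.integral_const_mul, integral_exp_mul_exp_exp_neg]
  ring

theorem integral_exp_cos_sin (β w a : ℝ) :
    ∫ t in a..(a + 2 * Real.pi), Complex.exp ((β * Real.cos t : ℝ) - (w * Real.sin t : ℝ) * Complex.I)
      = (2 * Real.pi * besselF ((β ^ 2 - w ^ 2) / 4) : ℝ) := by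
  -- These are the coefficients of `e^{it}` and `e^{-it}` in `β cos t - iw sin t`; their product is
  -- `(β² - w²)/4`.
  have h := integral_exp_mul_exp (((β - w) / 2 : ℝ)) (((β + w) / 2 : ℝ)) a
  have h2 := (((summable_besselF ((β ^ 2 - w ^ 2) / 4)).hasSum.mul_left (2 * Real.pi)).mapL
    Complex.ofRealCLM)
  have e : ∀ t : ℝ, Complex.exp ((β * Real.cos t : ℝ) - (w * Real.sin t : ℝ) * Complex.I) =
      Complex.exp (((β - w) / 2 : ℝ) * Complex.exp (1 * (t * Complex.I))) *
        Complex.exp (((β + w) / 2 : ℝ) * Complex.exp (-1 * (t * Complex.I))) := by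
    intro t
    rw [← Complex.exp_add]
    congr 1
    rw [show (-1 : ℂ) * (t * Complex.I) = ((-t : ℝ) : ℂ) * Complex.I by push_cast; ring, one_mul,
      Complex.exp_mul_I, Complex.exp_mul_I]
    push_cast
    rw [Complex.cos_neg, Complex.sin_neg]
    ring
  simp_rw [e]
  refine h.unique ?_
  convert h2 using 2 with k
  · simp only [Complex.ofRealCLM_apply]
    push_cast
    congr 3
    ring
  · rfl

/-- The integral representation behind the Fourier transform of the `cosh`-type window. -/
theorem integral_cosh_mul_exp (β w : ℝ) :
    ∫ t in (-(Real.pi / 2))..(Real.pi / 2), (Real.cosh (β * Real.cos t) : ℂ) *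
      Complex.exp (-(w * Real.sin t : ℝ) * Complex.I) =
      (Real.pi * besselF ((β ^ 2 - w ^ 2) / 4) : ℝ) := by
  have h := integral_exp_cos_sin β w (-(Real.pi / 2))
  set f : ℝ → ℂ := fun t =>
    Complex.exp ((β * Real.cos t : ℝ) - (w * Real.sin t : ℝ) * Complex.I) with hf
  have hfc : Continuous f := by fun_prop
  rw [← intervalIntegral.integral_add_adjacent_intervals (b := Real.pi / 2)
    (hfc.intervalIntegrable _ _) (hfc.intervalIntegrable _ _)] at h
  -- The reflection `t ↦ π - t` keeps `sin` and negates `cos`, so folding the period in half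
  -- produces `cosh`.
  have h2 := intervalIntegral.integral_comp_sub_left (a := -(Real.pi / 2)) (b := Real.pi / 2) f
    Real.pi
  rw [show Real.pi - Real.pi / 2 = Real.pi / 2 by ring,
    show Real.pi - -(Real.pi / 2) = -(Real.pi / 2) + 2 * Real.pi by ring] at h2
  rw [← h2, ← intervalIntegral.integral_add (hfc.intervalIntegrable _ _)
    (Continuous.intervalIntegrable (u := fun t => f (Real.pi - t)) (by fun_prop) _ _)] at h
  have e : ∀ t : ℝ, f t + f (Real.pi - t) = 2 * ((Real.cosh (β * Real.cos t) : ℂ) *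
      Complex.exp (-(w * Real.sin t : ℝ) * Complex.I)) := by
    intro t
    simp only [hf, Real.cos_pi_sub, Real.sin_pi_sub]
    rw [Complex.ofReal_cosh, Complex.cosh, sub_eq_add_neg, Complex.exp_add, sub_eq_add_neg,
      Complex.exp_add, neg_mul, mul_neg, Complex.ofReal_neg]
    ring
  simp_rw [e] at h
  rw [intervalIntegral.integral_const_mul] at h
  refine mul_left_cancel₀ (two_ne_zero (α := ℂ)) (h.trans ?_)
  push_cast; ring

theorem abs_besselJ0_le_one (x : ℝ) : |besselJ0 x| ≤ 1 := by
  have h := integral_cosh_mul_exp 0 x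
  simp only [zero_mul, Real.cosh_zero, Complex.ofReal_one, one_mul] at h
  have h2 : ‖∫ t in (-(Real.pi / 2))..(Real.pi / 2),
      Complex.exp (-(x * Real.sin t : ℝ) * Complex.I)‖ ≤ 1 * |Real.pi / 2 - -(Real.pi / 2)| := by
    refine intervalIntegral.norm_integral_le_of_norm_le_const fun t _ => ?_
    rw [← Complex.ofReal_neg, Complex.norm_exp_ofReal_mul_I]
  have e : (0 ^ 2 - x ^ 2) / 4 = -(x ^ 2 / 4) := by ring
  rw [h, e, Complex.norm_real, Real.norm_eq_abs, abs_mul, abs_of_pos Real.pi_pos,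
    show Real.pi / 2 - -(Real.pi / 2) = Real.pi by ring, abs_of_pos Real.pi_pos, one_mul] at h2
  exact le_of_mul_le_mul_left (by rw [mul_one]; exact h2) Real.pi_pos

/-- Laplace's method: the integral of `cosh(x cos t)` is at least its part over `|t| ≤ 1/√x`, where
`cos t ≥ 1 - t²/2` and `e^y ≥ 1 + y` leave an elementary integral of order `e^x/√x`. -/
theorem exp_le_mul_besselI0 {x : ℝ} (hx : 5 ≤ x) :
    Real.exp x ≤ (1 + 2 * x) * besselI0 x := by
  have hx0 : 0 < x := by linarith
  have hr : 0 < √x := Real.sqrt_pos.2 hx0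
  have hr2 : √x ^ 2 = x := Real.sq_sqrt hx0.le
  have h := integral_cosh_mul_exp x 0
  simp only [zero_mul, Complex.ofReal_zero, neg_zero, Complex.exp_zero, mul_one] at h
  rw [intervalIntegral.integral_ofReal, Complex.ofReal_inj, show x ^ 2 - 0 ^ 2 = x ^ 2 by ring,
    ← besselI0_eq] at h
  have hlow : ∀ t : ℝ, Real.exp x / 2 * (1 - x * t ^ 2 / 2) ≤ Real.cosh (x * Real.cos t) := by
    intro t
    have h1 : x * (1 - t ^ 2 / 2) ≤ x * Real.cos t := by
      gcongr; exact Real.one_sub_sq_div_two_le_cos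
    have h2 : Real.exp x * (1 - x * t ^ 2 / 2) ≤ Real.exp (x * Real.cos t) := by
      calc Real.exp x * (1 - x * t ^ 2 / 2) ≤ Real.exp x * Real.exp (-(x * t ^ 2 / 2)) := by
            gcongr; linarith [Real.add_one_le_exp (-(x * t ^ 2 / 2))]
        _ = Real.exp (x * (1 - t ^ 2 / 2)) := by rw [← Real.exp_add]; congr 1; ring
        _ ≤ _ := Real.exp_le_exp.2 h1
    rw [Real.cosh_eq]
    linarith [Real.exp_pos (-(x * Real.cos t))]
  have hcont : Continuous fun t => Real.cosh (x * Real.cos t) := by fun_prop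
  have hh : 1 / √x ≤ Real.pi / 2 := by
    have h1 : 1 / √x ≤ 1 := by
      rw [div_le_one hr]; exact Real.le_sqrt_of_sq_le (by linarith)
    linarith [Real.pi_gt_three]
  have hh0 : 0 < 1 / √x := by positivity
  have h1 : ∫ t in (-(1 / √x))..(1 / √x), Real.exp x / 2 * (1 - x * t ^ 2 / 2) ≤
      ∫ t in (-(1 / √x))..(1 / √x), Real.cosh (x * Real.cos t) :=
    intervalIntegral.integral_mono (by linarith)
      (Continuous.intervalIntegrable (by fun_prop) _ _) (hcont.intervalIntegrable _ _) hlow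
  have h2 : ∫ t in (-(1 / √x))..(1 / √x), Real.cosh (x * Real.cos t) ≤
      ∫ t in (-(Real.pi / 2))..(Real.pi / 2), Real.cosh (x * Real.cos t) :=
    intervalIntegral.integral_mono_interval (by linarith) (by linarith) hh
      (Filter.Eventually.of_forall fun t => (Real.cosh_pos _).le) (hcont.intervalIntegrable _ _)
  have h3 : ∫ t in (-(1 / √x))..(1 / √x), Real.exp x / 2 * (1 - x * t ^ 2 / 2) =
      Real.exp x * (5 / 6 / √x) := by
    have e : ∀ t, HasDerivAt (fun t => Real.exp x / 2 * (t - x * t ^ 3 / 6))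
        (Real.exp x / 2 * (1 - x * t ^ 2 / 2)) t := by
      intro t
      refine (((hasDerivAt_id t).sub (((hasDerivAt_pow 3 t).const_mul x).div_const 6)).const_mul
        (Real.exp x / 2)).congr_deriv ?_
      norm_num; ring
    rw [intervalIntegral.integral_eq_sub_of_hasDerivAt (fun t _ => e t)
      (Continuous.intervalIntegrable (by fun_prop) _ _)]
    have e3 : x * (1 / √x) ^ 3 = 1 / √x := by
      rw [show (1 / √x) ^ 3 = 1 / (√x ^ 2 * √x) by ring, hr2]; field_simp
    rw [show (-(1 / √x)) ^ 3 = -(1 / √x) ^ 3 by ring, mul_neg, e3]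
    field_simp; ring
  have h4 : Real.exp x * (5 / 6 / √x) ≤ Real.pi * besselI0 x := by rw [← h]; linarith
  have hpi := Real.pi_lt_d2
  have hI : 0 ≤ besselI0 x := by
    have : 0 ≤ Real.pi * besselI0 x := le_trans (by positivity) h4
    exact nonneg_of_mul_nonneg_right this Real.pi_pos
  have h5 : Real.exp x * 5 ≤ 18.9 * √x * besselI0 x := by
    have : Real.exp x * (5 / 6 / √x) * (6 * √x) = Real.exp x * 5 := by field_simp
    rw [← this]
    calc _ ≤ Real.pi * besselI0 x * (6 * √x) := by gcongr
      _ ≤ 3.15 * besselI0 x * (6 * √x) := by gcongr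
      _ = _ := by ring
  have h6 : 18.9 * √x ≤ 5 * (1 + 2 * x) := by nlinarith [sq_nonneg (√x - 2)]
  have h7 : 18.9 * √x * besselI0 x ≤ 5 * (1 + 2 * x) * besselI0 x := by gcongr
  linarith

/-! ### The Fourier transform of the window. -/

theorem image_sin_Ioo :
    Real.sin '' Set.Ioo (-(Real.pi / 2)) (Real.pi / 2) = Set.Ioo (-1) 1 := by
  refine Set.Subset.antisymm Real.mapsTo_sin_Ioo.image_subset fun y hy => ?_
  exact ⟨Real.arcsin y, ⟨Real.neg_pi_div_two_lt_arcsin.2 hy.1, Real.arcsin_lt_pi_div_two.2 hy.2⟩,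
    Real.sin_arcsin hy.1.le hy.2.le⟩

theorem integral_mcosh0_mul_exp (β w : ℝ) :
    ∫ x : ℝ, Complex.exp (-(w * x : ℝ) * Complex.I) * (mcosh0 β x : ℂ) =
      (Real.pi / (Real.cosh β - 1) *
        (besselF ((β ^ 2 - w ^ 2) / 4) - besselF (-(w ^ 2 / 4))) : ℝ) := by
  have hset : ∫ x : ℝ, Complex.exp (-(w * x : ℝ) * Complex.I) * (mcosh0 β x : ℂ) =
      ∫ x in Set.Ioo (-1 : ℝ) 1, Complex.exp (-(w * x : ℝ) * Complex.I) * (mcosh0 β x : ℂ) := by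
    refine (MeasureTheory.setIntegral_eq_integral_of_forall_compl_eq_zero fun x hx => ?_).symm
    rw [mcosh0, if_neg hx, Complex.ofReal_zero, mul_zero]
  rw [hset, ← image_sin_Ioo,
    MeasureTheory.integral_image_eq_integral_abs_deriv_smul measurableSet_Ioo
    (fun x _ => (Real.hasDerivAt_sin x).hasDerivWithinAt)
    (Real.injOn_sin.mono Set.Ioo_subset_Icc_self)]
  -- The Jacobian `cos t` cancels the singular factor `1/√(1 - x²)`. The subtracted `1` is written
  -- as `cosh(0 · cos t)`, so that one integral formula covers both parts.
  have e : Set.EqOn (fun t => |Real.cos t| •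
      (Complex.exp (-(w * Real.sin t : ℝ) * Complex.I) * (mcosh0 β (Real.sin t) : ℂ)))
      (fun t => (1 / (Real.cosh β - 1) : ℝ) *
        ((Real.cosh (β * Real.cos t) : ℂ) * Complex.exp (-(w * Real.sin t : ℝ) * Complex.I) -
        (Real.cosh (0 * Real.cos t) : ℂ) * Complex.exp (-(w * Real.sin t : ℝ) * Complex.I)))
      (Set.Ioo (-(Real.pi / 2)) (Real.pi / 2)) := by
    intro t ht
    have hc : 0 < Real.cos t := Real.cos_pos_of_mem_Ioo ht
    have hm : Real.sin t ∈ Set.Ioo (-1 : ℝ) 1 := Real.mapsTo_sin_Ioo ht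
    have hs : √(1 - Real.sin t ^ 2) = Real.cos t := by
      rw [← Real.cos_sq', Real.sqrt_sq hc.le]
    simp only
    rw [mcosh0, if_pos hm, hs, abs_of_pos hc, Complex.real_smul, zero_mul, Real.cosh_zero]
    have hc' : (Real.cos t : ℂ) ≠ 0 := by exact_mod_cast hc.ne'
    simp only [Complex.ofReal_mul, Complex.ofReal_div, Complex.ofReal_sub, Complex.ofReal_one]
    field_simp
  rw [MeasureTheory.setIntegral_congr_fun measurableSet_Ioo e, ← MeasureTheory.integral_Ioc_eq_integral_Ioo,
    ← intervalIntegral.integral_of_le (by linarith [Real.pi_pos]),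
    intervalIntegral.integral_const_mul, intervalIntegral.integral_sub,
    integral_cosh_mul_exp, integral_cosh_mul_exp]
  · rw [show (0 ^ 2 - w ^ 2) / 4 = -(w ^ 2 / 4) by ring]
    push_cast; ring
  · exact Continuous.intervalIntegrable (by fun_prop) _ _
  · exact Continuous.intervalIntegrable (by fun_prop) _ _

/-- The Fourier transform of the modified `cosh`-type window function. -/
theorem windowFT_mcoshWindow (σ : ℝ) {m N₁ : ℕ} (hm : 0 < m) (hN : 0 < N₁) (v : ℝ) :
    windowFT (mcoshWindow σ m N₁) v =
      ((m / N₁ : ℝ) * (Real.pi / (Real.cosh (shapeParam σ m) - 1) *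
        (besselF ((shapeParam σ m ^ 2 - (2 * Real.pi * m * (v / N₁)) ^ 2) / 4) -
          besselF (-((2 * Real.pi * m * (v / N₁)) ^ 2 / 4)))) : ℝ) := by
  have hm' : (0 : ℝ) < m := by exact_mod_cast hm
  have hN' : (0 : ℝ) < N₁ := by exact_mod_cast hN
  rw [Complex.ofReal_mul, ← integral_mcosh0_mul_exp, windowFT, Real.fourier_eq']
  have h := MeasureTheory.Measure.integral_comp_mul_left (fun x : ℝ =>
    Complex.exp (-(2 * Real.pi * m * (v / N₁) * x : ℝ) * Complex.I) *
      (mcosh0 (shapeParam σ m) x : ℂ)) ((N₁ : ℝ) / m)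
  rw [abs_of_pos (by positivity), inv_div, Complex.real_smul] at h
  rw [← h]
  congr 1; ext t
  rw [smul_eq_mul, mcoshWindow, show (N₁ : ℝ) / m * t = N₁ * t / m by ring]
  congr 2
  rw [← Complex.ofReal_neg]
  congr 2
  simp only [RCLike.inner_apply, conj_trivial]
  field_simp

/-! ### From Bessel sums to the error constant. -/

theorem besselDiff_neg (L b t : ℝ) : besselDiff L b (-t) = besselDiff L b t := by
  simp only [besselDiff, besselJ0, mul_neg, neg_sq]

theorem besselDiff_eq {L b t : ℝ} (h : b ^ 2 ≤ t ^ 2) :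
    besselF (((L * b) ^ 2 - (L * t) ^ 2) / 4) - besselF (-((L * t) ^ 2 / 4)) = besselDiff L b t := by
  have : 0 ≤ (L * t) ^ 2 - (L * b) ^ 2 := by nlinarith [sq_nonneg L]
  rw [besselDiff, besselJ0, besselJ0, Real.sq_sqrt this]
  congr 2; ring

theorem sum_nonzero_int_le {g : ℤ → ℝ} (hg : ∀ r, 0 ≤ g r) {B : ℝ}
    (h : ∀ K : ℕ, ∑ r ∈ Finset.Ico 1 K, (g r + g (-r)) ≤ B) (u : Finset {r : ℤ // r ≠ 0}) :
    ∑ r ∈ u, g r ≤ B := by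
  set K : ℕ := u.sup (fun r => (r : ℤ).natAbs) + 1 with hK
  refine le_trans ?_ (h K)
  have hsub : u.map (Function.Embedding.subtype _) ⊆
      (Finset.Ico 1 K).image (fun r : ℕ => (r : ℤ)) ∪
      (Finset.Ico 1 K).image (fun r : ℕ => -(r : ℤ)) := by
    intro r hr
    obtain ⟨⟨r, hr0⟩, hru, rfl⟩ := Finset.mem_map.1 hr
    have h1 : r.natAbs < K := Nat.lt_succ_of_le (Finset.le_sup (f := fun r : {r : ℤ // r ≠ 0} =>
      (r : ℤ).natAbs) hru)
    simp only [Finset.mem_union, Finset.mem_image, Finset.mem_Ico, Function.Embedding.subtype_apply]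
    rcases le_total 0 r with hr1 | hr1
    · exact Or.inl ⟨r.natAbs, ⟨by omega, h1⟩, by omega⟩
    · exact Or.inr ⟨r.natAbs, ⟨by omega, h1⟩, by omega⟩
  have hdisj : Disjoint ((Finset.Ico 1 K).image (fun r : ℕ => (r : ℤ)))
      ((Finset.Ico 1 K).image (fun r : ℕ => -(r : ℤ))) := by
    rw [Finset.disjoint_left]
    intro r h1 h2
    simp only [Finset.mem_image, Finset.mem_Ico] at h1 h2
    omega
  calc ∑ r ∈ u, g r = ∑ r ∈ u.map (Function.Embedding.subtype _), g r := by
        rw [Finset.sum_map]; rfl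
    _ ≤ _ := Finset.sum_le_sum_of_subset_of_nonneg hsub fun r _ _ => hg r
    _ = _ := by
        rw [Finset.sum_union hdisj, Finset.sum_image (by intro a _ b _ h; simpa using h),
          Finset.sum_image (by intro a _ b _ h; simpa using h), Finset.sum_add_distrib]

theorem sum_abs_besselDiff_int_le {m : ℕ} (hm : 2 ≤ m) {b s : ℝ} (hb : 0.6 ≤ b) (hb' : b ≤ 0.75)
    (hs : |s| ≤ 1 - b) (u : Finset {r : ℤ // r ≠ 0}) :
    ∑ r ∈ u, |besselDiff (2 * Real.pi * m) b (s + (r : ℤ))| ≤ 5.25 - 3 / (2 * Real.pi * m) := by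
  refine sum_nonzero_int_le (g := fun r : ℤ => |besselDiff (2 * Real.pi * m) b (s + r)|)
    (fun _ => abs_nonneg _) (fun K => ?_) u
  refine le_trans (le_of_eq ?_)
    (sum_besselDiff_le hm hb hb' (abs_nonneg s) hs abs_besselJ0_le_one K)
  refine Finset.sum_congr rfl fun r _ => ?_
  have e1 : s + ((-(r : ℤ) : ℤ) : ℝ) = -(r - s) := by push_cast; ring
  have e2 : s + (((r : ℤ)) : ℝ) = r + s := by push_cast; ring
  rw [e1, e2, besselDiff_neg]
  -- Changing the sign of `s` only swaps the terms for `r` and `-r`, so `s ≥ 0` may be assumed.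
  rcases abs_cases s with ⟨h, _⟩ | ⟨h, _⟩
  · rw [h]; ring
  · rw [h, sub_neg_eq_add, ← sub_eq_add_neg]

/-- Four terms of the series suffice, being cubic in `x²/4`. The slope is chosen so that `(3/L) ·
2.625L = 7.875 = (21/4)(3/2)`, exactly the cost of passing from `I₀ + 1/2` to `I₀ - 1`. -/
theorem linear_le_besselI0 {L x : ℝ} (hL : 12.566 ≤ L) (hx : 0.2 * L ^ 2 ≤ x ^ 2) :
    2.625 * L ≤ besselI0 x + 1 / 2 := by
  have h := sum_le_besselF (z := x ^ 2 / 4) (by positivity) 4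
  rw [← besselI0_eq] at h
  norm_num [Finset.sum_range_succ, Nat.factorial] at h
  have hz : 7.89 ≤ x ^ 2 / 4 := by nlinarith
  have hz' : 0.05 * L ^ 2 ≤ x ^ 2 / 4 := by linarith
  generalize x ^ 2 / 4 = z at *
  have h1 : 7.89 * z ≤ z ^ 2 := by nlinarith
  have h2 : 7.89 ^ 2 * z ≤ z ^ 3 := by nlinarith
  nlinarith

/-- The relative frequencies `n / N₁` of `n ∈ I_N` are at most `1 / (2σ)` in absolute value. -/
theorem abs_div_le_of_mem_indexSet {σ : ℝ} (hσ : 5 / 4 ≤ σ) {N N₁ : ℕ} (h : Admissible σ N N₁)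
    {n : ℤ} (hn : n ∈ indexSet N) : 0 < N₁ ∧ |(n : ℝ) / N₁| ≤ 1 / (2 * σ) := by
  obtain ⟨hN, hNe, -, hN₁⟩ := h
  have hN' : (0 : ℝ) < N := by exact_mod_cast hN
  have hpos : (0 : ℝ) < N₁ := by rw [hN₁]; positivity
  refine ⟨by exact_mod_cast hpos, ?_⟩
  have hn2 : |(n : ℝ)| ≤ N / 2 := by
    simp only [indexSet, Finset.mem_Ico] at hn
    obtain ⟨k, rfl⟩ := hNe
    have h1 : -(k : ℤ) ≤ n := by omega
    have h2 : n ≤ (k : ℤ) := by omega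
    have h1' : -(k : ℝ) ≤ n := by exact_mod_cast h1
    have h2' : (n : ℝ) ≤ k := by exact_mod_cast h2
    push_cast
    rw [abs_le]; constructor <;> linarith
  rw [abs_div, abs_of_pos hpos, div_le_div_iff₀ hpos (by linarith), hN₁]
  nlinarith

theorem shapeParam_bounds {σ : ℝ} (hσ : σ ∈ Set.Icc (5 / 4 : ℝ) 2) :
    0.6 ≤ 1 - 1 / (2 * σ) ∧ 1 - 1 / (2 * σ) ≤ 0.75 ∧ 0.2 ≤ 1 - 1 / σ := by
  have h1 : 1 / σ ≤ 0.8 := by rw [div_le_iff₀ (by linarith [hσ.1])]; linarith [hσ.1]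
  have h2 : 0.5 ≤ 1 / σ := by rw [le_div_iff₀ (by linarith [hσ.1])]; linarith [hσ.2]
  have h3 : 1 / (2 * σ) = 1 / σ / 2 := by field_simp
  rw [h3]
  exact ⟨by linarith, by linarith, by linarith⟩

/-- A lower bound for the Fourier transform of the window at the frequencies of `I_N`. -/
theorem besselI0_sub_one_le {L σ s : ℝ} (hσ : σ ∈ Set.Icc (5 / 4 : ℝ) 2)
    (hs : |s| ≤ 1 / (2 * σ)) :
    besselI0 (L * √(1 - 1 / σ)) - 1 ≤
      besselF (((L * (1 - 1 / (2 * σ))) ^ 2 - (L * s) ^ 2) / 4) - besselF (-((L * s) ^ 2 / 4)) := by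
  have h1 : besselF (-((L * s) ^ 2 / 4)) ≤ 1 :=
    (le_abs_self _).trans (abs_besselJ0_le_one (L * s))
  have h2 : 0 ≤ 1 - 1 / σ := by linarith [(shapeParam_bounds hσ).2.2]
  have h3 : besselI0 (L * √(1 - 1 / σ)) ≤
      besselF (((L * (1 - 1 / (2 * σ))) ^ 2 - (L * s) ^ 2) / 4) := by
    rw [besselI0_eq]
    refine besselF_mono (by positivity) ?_
    rw [mul_pow, Real.sq_sqrt h2]
    have h4 : s ^ 2 ≤ (1 / (2 * σ)) ^ 2 := sq_le_sq' (abs_le.1 hs).1 (abs_le.1 hs).2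
    have h5 : 1 - 1 / σ = (1 - 1 / (2 * σ)) ^ 2 - (1 / (2 * σ)) ^ 2 := by
      have : σ ≠ 0 := by linarith [hσ.1]
      field_simp; ring
    have h6 : L ^ 2 * s ^ 2 ≤ L ^ 2 * (1 / (2 * σ)) ^ 2 := by gcongr
    rw [h5]
    linarith
  linarith

theorem sum_norm_aliasTerm_le {σ : ℝ} (hσ : σ ∈ Set.Icc (5 / 4 : ℝ) 2) {m : ℕ} (hm : 2 ≤ m)
    {N N₁ : ℕ} (h : Admissible σ N N₁) {n : ℤ} (hn : n ∈ indexSet N) :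
    windowFT (mcoshWindow σ m N₁) n ≠ 0 ∧
    ∀ u : Finset {r : ℤ // r ≠ 0}, ∑ r ∈ u, ‖aliasTerm (mcoshWindow σ m N₁) N₁ n r‖ ≤
      21 / 4 * (besselI0 (2 * Real.pi * m * √(1 - 1 / σ)) + 1 / 2)⁻¹ := by
  have hm' : (2 : ℝ) ≤ m := by exact_mod_cast hm
  have hpi := Real.pi_gt_d6
  have hL : 12.566 ≤ 2 * Real.pi * m := by nlinarith
  obtain ⟨hN, hs⟩ := abs_div_le_of_mem_indexSet hσ.1 h hn
  have hN' : (0 : ℝ) < N₁ := by exact_mod_cast hN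
  obtain ⟨hb, hb', hσ'⟩ := shapeParam_bounds hσ
  have hI := linear_le_besselI0 (x := 2 * Real.pi * m * √(1 - 1 / σ)) hL (by
    rw [mul_pow _ √_, Real.sq_sqrt (by linarith)]; nlinarith [sq_nonneg (2 * Real.pi * m)])
  have hsum := sum_abs_besselDiff_int_le (s := (n : ℝ) / N₁) hm hb hb' (by linarith)
  have hden := besselI0_sub_one_le (L := 2 * Real.pi * m) hσ hs
  have hFT := windowFT_mcoshWindow σ (by omega : 0 < m) hN
  set c : ℝ := (m / N₁ : ℝ) * (Real.pi / (Real.cosh (shapeParam σ m) - 1)) with hc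
  have hβ : shapeParam σ m = 2 * Real.pi * m * (1 - 1 / (2 * σ)) := rfl
  have hc0 : 0 < c := by
    have : 0 < Real.cosh (shapeParam σ m) - 1 := by
      rw [sub_pos, Real.one_lt_cosh, hβ]
      have : 0 < 2 * Real.pi * m * (1 - 1 / (2 * σ)) := mul_pos (by linarith) (by linarith)
      exact this.ne'
    positivity
  set D := besselF (((2 * Real.pi * m * (1 - 1 / (2 * σ))) ^ 2 -
    (2 * Real.pi * m * ((n : ℝ) / N₁)) ^ 2) / 4) -
    besselF (-((2 * Real.pi * m * ((n : ℝ) / N₁)) ^ 2 / 4)) with hD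
  have hn0 : windowFT (mcoshWindow σ m N₁) n = ((c * D : ℝ) : ℂ) := by
    rw [hFT, hc, hD, hβ]; congr 1; ring
  have hnr : ∀ r : {r : ℤ // r ≠ 0}, windowFT (mcoshWindow σ m N₁) ((n : ℝ) + (r : ℤ) * N₁) =
      ((c * besselDiff (2 * Real.pi * m) (1 - 1 / (2 * σ)) ((n : ℝ) / N₁ + (r : ℤ)) : ℝ) : ℂ) := by
    rintro ⟨r, hr⟩
    have e : ((n : ℝ) + r * N₁) / N₁ = n / N₁ + r := by field_simp
    have hr1 : 1 ≤ |(r : ℝ)| := by exact_mod_cast Int.one_le_abs hr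
    -- Every aliased frequency lies where the argument of `F` is nonpositive, so the difference is
    -- expressed through `J₀`.
    have hle : 1 - 1 / (2 * σ) ≤ |(n : ℝ) / N₁ + r| := by
      have := abs_sub_abs_le_abs_sub (r : ℝ) (-((n : ℝ) / N₁))
      rw [abs_neg, sub_neg_eq_add, add_comm (r : ℝ)] at this
      linarith
    rw [hFT, ← besselDiff_eq (sq_le_sq.2 (by rwa [abs_of_pos (by linarith : 0 < 1 - 1 / (2 * σ))])),
      hc, hβ, e]
    congr 1; ring
  have hD0 : 0 < D := by linarith
  refine ⟨by rw [hn0]; exact_mod_cast (mul_pos hc0 hD0).ne', fun u => ?_⟩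
  have hterm : ∀ r : {r : ℤ // r ≠ 0}, ‖aliasTerm (mcoshWindow σ m N₁) N₁ n r‖ =
      |besselDiff (2 * Real.pi * m) (1 - 1 / (2 * σ)) ((n : ℝ) / N₁ + (r : ℤ))| / D := by
    intro r
    rw [aliasTerm, norm_smul, fourier_norm, mul_one, hnr, hn0, ← Complex.ofReal_div,
      mul_div_mul_left _ _ hc0.ne', Complex.norm_real, Real.norm_eq_abs, abs_div, abs_of_pos hD0]
  simp_rw [hterm]
  rw [← Finset.sum_div, ← div_eq_mul_inv, div_le_div_iff₀ hD0 (by linarith)]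
  set I := besselI0 (2 * Real.pi * m * √(1 - 1 / σ))
  have hu := hsum u
  have hL0 : 0 < 2 * Real.pi * m := by linarith
  have h3 : 7.875 ≤ 3 / (2 * Real.pi * m) * (I + 1 / 2) := by
    rw [div_mul_eq_mul_div, le_div_iff₀ hL0]; linarith
  calc _ ≤ (5.25 - 3 / (2 * Real.pi * m)) * (I + 1 / 2) := by gcongr; linarith
    _ ≤ 21 / 4 * (I - 1) := by linarith
    _ ≤ 21 / 4 * D := by gcongr

theorem errorConst_le {σ B : ℝ} {φ : ℕ → ℝ → ℝ}
    (h : ∀ N N₁ : ℕ, Admissible σ N N₁ → ∀ n ∈ indexSet N, ∀ u : Finset {r : ℤ // r ≠ 0},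
      ∑ r ∈ u, ‖aliasTerm (φ N₁) N₁ n r‖ ≤ B) :
    errorConst σ φ ≤ ENNReal.ofReal B := by
  refine iSup_le fun N => iSup_le fun N₁ => iSup_le fun hN => iSup_le fun n => iSup_le fun hn => ?_
  have hu := h N N₁ hN n hn
  rw [← ofReal_norm]
  refine ENNReal.ofReal_le_ofReal ?_
  have hs := summable_of_sum_le (fun _ => norm_nonneg _) hu
  exact (norm_tsum_le_tsum_norm hs).trans (hs.tsum_le_of_sum_le hu)

theorem theorem5p6 (σ : ℝ) (hσ : σ ∈ Set.Icc (5 / 4 : ℝ) 2) (m : ℕ) (hm : 2 ≤ m) :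
    -- the error constant is well defined: no division by zero, and the series converge in `C(𝕋)`
    (∀ N N₁ : ℕ, Admissible σ N N₁ → ∀ n ∈ indexSet N,
      windowFT (mcoshWindow σ m N₁) n ≠ 0 ∧
      Summable (fun r : {r : ℤ // r ≠ 0} => aliasTerm (mcoshWindow σ m N₁) N₁ n r)) ∧
    -- the bound through the modified Bessel function
    errorConst σ (mcoshWindow σ m) ≤
      ENNReal.ofReal (21 / 4 * (besselI0 (2 * Real.pi * m * √(1 - 1 / σ)) + 1 / 2)⁻¹) ∧
    -- the explicit exponentially decaying bound
    errorConst σ (mcoshWindow σ m) ≤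
      ENNReal.ofReal (21 / 4 * (1 + 4 * Real.pi * m * √(1 - 1 / σ)) *
        (Real.exp (2 * Real.pi * m * √(1 - 1 / σ)) + 1 / 2
          + 2 * Real.pi * m * √(1 - 1 / σ))⁻¹) := by
  have key := fun N N₁ (h : Admissible σ N N₁) n (hn : n ∈ indexSet N) =>
    sum_norm_aliasTerm_le hσ hm h hn
  have hmain : errorConst σ (mcoshWindow σ m) ≤
      ENNReal.ofReal (21 / 4 * (besselI0 (2 * Real.pi * m * √(1 - 1 / σ)) + 1 / 2)⁻¹) :=
    errorConst_le fun N N₁ h n hn => (key N N₁ h n hn).2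
  refine ⟨fun N N₁ h n hn => ⟨(key N N₁ h n hn).1, ?_⟩, hmain, hmain.trans ?_⟩
  · exact (summable_of_sum_le (fun _ => norm_nonneg _) (key N N₁ h n hn).2).of_norm
  refine ENNReal.ofReal_le_ofReal ?_
  have hm' : (2 : ℝ) ≤ m := by exact_mod_cast hm
  have hσ' := (shapeParam_bounds hσ).2.2
  have hx : 5 ≤ 2 * Real.pi * m * √(1 - 1 / σ) := by
    have h1 : 0.44 ≤ √(1 - 1 / σ) := Real.le_sqrt_of_sq_le (le_trans (by norm_num) hσ')
    have h2 : 12.5 ≤ 2 * Real.pi * m := by nlinarith [Real.pi_gt_d6]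
    nlinarith
  have hexp := exp_le_mul_besselI0 hx
  rw [show 4 * Real.pi * m * √(1 - 1 / σ) = 2 * (2 * Real.pi * m * √(1 - 1 / σ)) by ring]
  generalize 2 * Real.pi * m * √(1 - 1 / σ) = x at *
  have hI : 0 < besselI0 x :=
    pos_of_mul_pos_right ((Real.exp_pos x).trans_le hexp) (by linarith)
  rw [mul_assoc]
  gcongr
  -- Cross-multiplied, the claim is `e^x + 1/2 + x ≤ (1 + 2x)(I₀(x) + 1/2)`; the terms `1/2 + x`
  -- match exactly.
  rw [← div_eq_mul_inv, ← one_div, div_le_div_iff₀ (by linarith) (by positivity)]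
  linarith
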